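/- Fix integers $d\ge 2$, $D\ge 0$, $r\ge 0$. On a ring of $L$ qudits with Hilbert space $(\mathbb{C}^d)^{\otimes L}$ let $T$ be the translation by one site, $P_{\mathcal T}=\frac1L\sum_{n=0}^{L-1}T^n$ the projector onto the zero-momentum subspace, and $\rho_{\mathcal T}=P_{\mathcal T}/\operatorname{Tr}P_{\mathcal T}$ the maximally mixed translation-invariant state. A local unitary circuit of depth $D$ and range $r$ is a product of $D$ layers, each of which is a product of unitary gates acting on pairwise disjoint contiguous regions of at most $r$ sites (a layer may be trivial). (i) ($\rho_{\mathcal T}$ is long-range bipartite entangled for large $L$.) There is $L_0=L_0(d,D,r)$ such that for every $L\ge L_0$ the state $\rho_{\mathcal T}$ is not a mixture $\sum_\alpha p_\alpha|\psi_\alpha\rangle\langle\psi_\alpha|$ (with $p_\alpha\ge0$, $\sum_\alpha p_\alpha=1$) of pure states of the form $|\psi_\alpha\rangle=U_\alpha|A_\alpha\rangle|B_\alpha\rangle$, where $U_\alpha$ is a local unitary circuit of depth $D$ and range $r$ and $|A_\alpha\rangle$, $|B_\alpha\rangle$ are normalized states of two complementary nonempty contiguous regions of the ring. The circuits and the regions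 may depend on $\alpha$. (ii) There are $\ell$, $D'$, $r'$, depending only on $d$, $D$ and $r$, such that for every $L$ the following holds. Let $|\Psi\rangle\in(\mathbb{C}^d)^{\otimes L}$ be translationally symmetric, i.e. $T|\Psi\rangle\propto|\Psi\rangle$, and of the form $|\Psi\rangle=U|A\rangle|B\rangle$, where $U$ is a local unitary circuit of depth $D$ and range $r$ and $|A\rangle$, $|B\rangle$ are normalized states of two complementary contiguous regions of at least $\ell$ sites each. Then $|\Psi\rangle=V\,|\phi_1\rangle\otimes\cdots\otimes|\phi_L\rangle$ for some local unitary circuit $V$ of depth $D'$ and range $r'$ and some normalized single-site states $|\phi_i\rangle\in\mathbb{C}^d$. -/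

import Mathlib

open scoped Matrix

noncomputable section

namespace TranslationMMIS

/-- Labels `σ = (σ₁, …, σ_L)` of the computational basis of a chain of `L` qudits of dimension `d`;
the sites `Fin L` form a ring, with `finRotate L : i ↦ i + 1 mod L` as the shift of sites. -/
abbrev Config (d L : ℕ) : Type := Fin L → Fin d

/-- The Hilbert space `(ℂ^d)^{⊗ L}`, written in the computational basis. -/
abbrev Ket (d L : ℕ) : Type := EuclideanSpace ℂ (Config d L)

/-- Operators on `(ℂ^d)^{⊗ L}`, as matrices in the computational basis. -/
abbrev Op (d L : ℕ) : Type := Matrix (Config d L) (Config d L) ℂ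

/-- The translation by one site: `T |τ⟩ = |σ⟩` with `σ (i + 1) = τ i`. -/
def translation (d L : ℕ) : Op d L :=
  Matrix.of fun σ τ => if τ = σ ∘ finRotate L then 1 else 0

/-- `P = (1 / L) (1 + T + ⋯ + T ^ (L - 1))`, the projector onto the zero-momentum subspace. -/
def translationProjector (d L : ℕ) : Op d L :=
  (L : ℂ)⁻¹ • ∑ n ∈ Finset.range L, translation d L ^ n

/-- The maximally mixed invariant state of translation: `P` normalized to trace one. -/
def mmis (d L : ℕ) : Op d L :=
  (translationProjector d L).trace⁻¹ • translationProjector d L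

variable {d L : ℕ}

/-- The rank-one operator `|Ψ⟩⟨Ψ|`. -/
def ketBra (Ψ : Ket d L) : Op d L :=
  Matrix.vecMulVec Ψ.ofLp (star Ψ.ofLp)

/-- `Ψ` is an eigenvector of translation, with any momentum. -/
def IsTranslationSymmetric (Ψ : Ket d L) : Prop :=
  ∃ c : ℂ, translation d L *ᵥ Ψ.ofLp = c • Ψ.ofLp

/-- The contiguous region of the ring that consists of `i, i + 1, …, i + n - 1` (mod `L`). -/
def arc (i : Fin L) (n : ℕ) : Finset (Fin L) :=
  (Finset.range n).image fun k => (finRotate L ^ k) i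

/-- `S` is a contiguous region of the ring. -/
def IsArc (S : Finset (Fin L)) : Prop :=
  ∃ (i : Fin L) (n : ℕ), S = arc i n

/-- `M = u ⊗ 1` for some operator `u` on the sites in `S`. -/
def ActsOn (S : Finset (Fin L)) (M : Op d L) : Prop :=
  ∃ u : Matrix (S → Fin d) (S → Fin d) ℂ, ∀ σ τ : Config d L,
    M σ τ = if ∀ i ∉ S, σ i = τ i then u (S.restrict σ) (S.restrict τ) else 0

/-- A layer of a local circuit: a product of finitely many unitary gates that act on pairwise
disjoint contiguous regions of at most `r` sites each. -/
def IsLocalLayer (r : ℕ) (M : Op d L) : Prop :=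
  ∃ (n : ℕ) (S : Fin n → Finset (Fin L)) (G : Fin n → Op d L),
    (∀ j k, j ≠ k → Disjoint (S j) (S k)) ∧
    (∀ k, IsArc (S k) ∧ (S k).card ≤ r) ∧
    (∀ k, G k ∈ Matrix.unitaryGroup (Config d L) ℂ ∧ ActsOn (S k) (G k)) ∧
    M = (List.ofFn G).prod

/-- A local unitary circuit of depth (at most) `D` with gates of range at most `r`: a product of
`D` layers, each of which may be trivial. -/
def IsLocalCircuit (D r : ℕ) (U : Op d L) : Prop :=
  ∃ layer : Fin D → Op d L,
    (∀ k, IsLocalLayer r (layer k)) ∧ U = (List.ofFn layer).prod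

/-- `Φ = |a⟩ ⊗ |b⟩` with normalized states `|a⟩` of the region `A` and `|b⟩` of its complement. -/
def IsBipartiteProduct (A : Finset (Fin L)) (Φ : Ket d L) : Prop :=
  ∃ (a : EuclideanSpace ℂ (A → Fin d)) (b : EuclideanSpace ℂ ((Aᶜ : Finset (Fin L)) → Fin d)),
    ‖a‖ = 1 ∧ ‖b‖ = 1 ∧ ∀ σ : Config d L, Φ σ = a (A.restrict σ) * b (Aᶜ.restrict σ)

/-- `Φ = |φ₁⟩ ⊗ ⋯ ⊗ |φ_L⟩` with normalized states `|φᵢ⟩` of the single sites. -/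
def IsProductState (Φ : Ket d L) : Prop :=
  ∃ φ : Fin L → EuclideanSpace ℂ (Fin d),
    (∀ i, ‖φ i‖ = 1) ∧ ∀ σ : Config d L, Φ σ = ∏ i, φ i (σ i)

/-- `Ψ = U |A⟩|B⟩`, with `B` the complement of `A` and `U` a local unitary circuit of depth `D` and
range `r`. -/
def IsCircuitOfBipartiteProduct (D r : ℕ) (A : Finset (Fin L)) (Ψ : Ket d L) : Prop :=
  ∃ (U : Op d L) (Φ : Ket d L), IsLocalCircuit D r U ∧ IsBipartiteProduct A Φ ∧
    Ψ.ofLp = U *ᵥ Φ.ofLp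

/-- `Ψ` is prepared from a product state by a local unitary circuit of depth `D` and range `r`. -/
def IsCircuitOfProductState (D r : ℕ) (Ψ : Ket d L) : Prop :=
  ∃ (V : Op d L) (Φ : Ket d L), IsLocalCircuit D r V ∧ IsProductState Φ ∧
    Ψ.ofLp = V *ᵥ Φ.ofLp

/-- The density matrices that are mixtures of pure states `U |A⟩|B⟩`; the circuit `U` of depth `D`
and range `r` and the division of the ring into two nonempty contiguous regions `A | B` may differ
from one pure state of the mixture to another. -/
def shortRangeBipartiteMixtures (d L D r : ℕ) : Set (Op d L) :=
  convexHull ℝ {ρ | ∃ (A : Finset (Fin L)) (Ψ : Ket d L), IsArc A ∧ A.Nonempty ∧ Aᶜ.Nonempty ∧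
    IsCircuitOfBipartiteProduct D r A Ψ ∧ ρ = ketBra Ψ}

end TranslationMMIS

end

/-! Only the gates in the light cones of the two ends of `A`, of half-width `w = 1 + D * r`, act
across the cut. So there are unitaries `C`, `C'` supported near the two ends for which `C' C Ψ`
factorizes over `A` and its complement (`exists_disentangler`).

For (ii), let `E`, `E'` be the translates of `C`, `C'` by `s` sites. If `A` and its complement are
long, all four unitaries commute, and `E' E C' C Ψ` factorizes over `A` and over `A + s`, hence over
the first `s` sites of `A`, which form the intersection of `A` with the complement of `A + s`
(`Factorizes.inter`). There `C'` and `E'` act outside and can be undone, so `E C Ψ` factorizes over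
a short segment: translates of the single unitary `C` cut `Ψ` wherever they are placed
(`factorizes_seg`). One layer of such translates makes `Ψ` a product over blocks, and a second layer
prepares the blocks.

For (i), a mixture equal to the maximally mixed invariant state contains only zero-momentum states
(`mulVec_eq_of_sum_eq_mmis`). By the argument above, or directly if `A` or its complement is short,
each of them is orthogonal to some unit vector `v` on `m = 8 * w` neighbouring sites
(`exists_annihilator`), and by invariance on every translate of these sites. It is therefore fixed
by the product of the projectors `1 - |v⟩⟨v|` over `K = L / m` disjoint segments, whose range is a
fraction `(1 - d^(-m))^K` of the Hilbert space. As `v` varies over the mixture, it is replaced by a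
point of a net whose size is polynomial in `K`. The invariant state is at most `L / d^L` times the
identity, so each net point carries weight at most `L (1 - d^(-m))^K`. The total weight would tend
to zero as `L` grows, yet it is at least `1/4` (`le_of_sum_eq_mmis`). -/

noncomputable section

open scoped Kronecker

namespace TranslationMMIS

variable {d L : ℕ}

/-! ### Operators supported on a set of sites -/

/-- A configuration of the ring is a configuration of `S` together with one of its complement. -/
def splitEquiv (d : ℕ) (S : Finset (Fin L)) :
    Config d L ≃ (S → Fin d) × ((Sᶜ : Finset (Fin L)) → Fin d) where
  toFun σ := (S.restrict σ, Sᶜ.restrict σ)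
  invFun p := fun i => if h : i ∈ S then p.1 ⟨i, h⟩ else p.2 ⟨i, Finset.mem_compl.2 h⟩
  left_inv σ := by ext i; by_cases h : i ∈ S <;> simp [h]
  right_inv p := by
    ext i
    · simp
    · have := Finset.mem_compl.1 i.2
      simp [this]

theorem splitEquiv_apply (S : Finset (Fin L)) (σ : Config d L) :
    splitEquiv d S σ = (S.restrict σ, Sᶜ.restrict σ) := rfl

theorem restrict_splitEquiv_symm (S : Finset (Fin L)) (a : S → Fin d)
    (b : (Sᶜ : Finset (Fin L)) → Fin d) : S.restrict ((splitEquiv d S).symm (a, b)) = a :=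
  congrArg Prod.fst ((splitEquiv d S).apply_symm_apply (a, b))

theorem restrict_compl_splitEquiv_symm (S : Finset (Fin L)) (a : S → Fin d)
    (b : (Sᶜ : Finset (Fin L)) → Fin d) : Sᶜ.restrict ((splitEquiv d S).symm (a, b)) = b :=
  congrArg Prod.snd ((splitEquiv d S).apply_symm_apply (a, b))

theorem splitEquiv_symm_restrict (S : Finset (Fin L)) (σ τ : Config d L) :
    (splitEquiv d S).symm (S.restrict σ, Sᶜ.restrict τ) = S.piecewise σ τ := by
  ext i; by_cases h : i ∈ S <;> simp [splitEquiv, h]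

theorem restrict_eq_restrict_iff (S : Finset (Fin L)) (σ τ : Config d L) :
    S.restrict σ = S.restrict τ ↔ ∀ i ∈ S, σ i = τ i := by
  simp [funext_iff]

/-- The operator `u ⊗ 1`, with `u` acting on the sites in `S`. -/
def localOp (S : Finset (Fin L)) (u : Matrix (S → Fin d) (S → Fin d) ℂ) : Op d L :=
  (u ⊗ₖ (1 : Matrix ((Sᶜ : Finset (Fin L)) → Fin d) _ ℂ)).submatrix
    (splitEquiv d S) (splitEquiv d S)

theorem localOp_apply (S : Finset (Fin L)) (u : Matrix (S → Fin d) (S → Fin d) ℂ)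
    (σ τ : Config d L) :
    localOp S u σ τ = if ∀ i ∉ S, σ i = τ i then u (S.restrict σ) (S.restrict τ) else 0 := by
  have h : Sᶜ.restrict σ = Sᶜ.restrict τ ↔ ∀ i ∉ S, σ i = τ i := by
    simp [restrict_eq_restrict_iff]
  simp only [localOp, Matrix.submatrix_apply, splitEquiv_apply, Matrix.kroneckerMap_apply,
    Matrix.one_apply, h]
  split_ifs <;> simp

theorem actsOn_iff (S : Finset (Fin L)) (M : Op d L) : ActsOn S M ↔ ∃ u, M = localOp S u := by
  constructor
  · rintro ⟨u, hu⟩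
    exact ⟨u, by ext σ τ; rw [hu, localOp_apply]⟩
  · rintro ⟨u, rfl⟩
    exact ⟨u, localOp_apply S u⟩

theorem actsOn_localOp (S : Finset (Fin L)) (u : Matrix (S → Fin d) (S → Fin d) ℂ) :
    ActsOn S (localOp S u) := (actsOn_iff S _).2 ⟨u, rfl⟩

theorem localOp_one (S : Finset (Fin L)) :
    localOp S (1 : Matrix (S → Fin d) (S → Fin d) ℂ) = 1 := by
  simp [localOp]

theorem localOp_mul (S : Finset (Fin L)) (u v : Matrix (S → Fin d) (S → Fin d) ℂ) :
    localOp S (u * v) = localOp S u * localOp S v := by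
  rw [localOp, localOp, localOp, Matrix.submatrix_mul_equiv, ← Matrix.mul_kronecker_mul, mul_one]

theorem localOp_sub (S : Finset (Fin L)) (u v : Matrix (S → Fin d) (S → Fin d) ℂ) :
    localOp S (u - v) = localOp S u - localOp S v := by
  ext σ τ
  simp only [localOp_apply, Matrix.sub_apply]
  split_ifs <;> simp

theorem localOp_conjTranspose (S : Finset (Fin L)) (u : Matrix (S → Fin d) (S → Fin d) ℂ) :
    localOp S uᴴ = (localOp S u)ᴴ := by
  simp [localOp, Matrix.conjTranspose_submatrix, Matrix.conjTranspose_kronecker]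

theorem trace_submatrix_splitEquiv (S : Finset (Fin L))
    (M : Matrix ((S → Fin d) × ((Sᶜ : Finset (Fin L)) → Fin d)) _ ℂ) :
    (M.submatrix (splitEquiv d S) (splitEquiv d S)).trace = M.trace :=
  Fintype.sum_equiv (splitEquiv d S) _ _ fun _ => rfl

theorem localOp_compl_eq (S : Finset (Fin L)) {N : Op d L} (hN : ActsOn Sᶜ N) :
    ∃ v : Matrix ((Sᶜ : Finset (Fin L)) → Fin d) _ ℂ,
      N = ((1 : Matrix (S → Fin d) _ ℂ) ⊗ₖ v).submatrix (splitEquiv d S) (splitEquiv d S) := by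
  obtain ⟨v, hv⟩ := hN
  refine ⟨v, ?_⟩
  ext σ τ
  have h : S.restrict σ = S.restrict τ ↔ ∀ i ∉ Sᶜ, σ i = τ i := by
    simp [restrict_eq_restrict_iff]
  simp only [hv, Matrix.submatrix_apply, splitEquiv_apply, Matrix.kroneckerMap_apply,
    Matrix.one_apply, h]
  split_ifs <;> simp

theorem ActsOn.one (S : Finset (Fin L)) : ActsOn S (1 : Op d L) :=
  (actsOn_iff S _).2 ⟨1, (localOp_one S).symm⟩

theorem ActsOn.mul {S : Finset (Fin L)} {M N : Op d L} (hM : ActsOn S M) (hN : ActsOn S N) :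
    ActsOn S (M * N) := by
  obtain ⟨u, rfl⟩ := (actsOn_iff S M).1 hM
  obtain ⟨v, rfl⟩ := (actsOn_iff S N).1 hN
  exact (actsOn_iff S _).2 ⟨u * v, (localOp_mul S u v).symm⟩

theorem ActsOn.conjTranspose {S : Finset (Fin L)} {M : Op d L} (hM : ActsOn S M) :
    ActsOn S Mᴴ := by
  obtain ⟨u, rfl⟩ := (actsOn_iff S M).1 hM
  exact (actsOn_iff S _).2 ⟨uᴴ, (localOp_conjTranspose S u).symm⟩

theorem ActsOn.mono {S S' : Finset (Fin L)} (h : S ⊆ S') {M : Op d L} (hM : ActsOn S M) :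
    ActsOn S' M := by
  obtain ⟨u, hu⟩ := hM
  refine ⟨fun a b => if ∀ i : S', i.1 ∉ S → a i = b i then
    u (fun i => a ⟨i, h i.2⟩) (fun i => b ⟨i, h i.2⟩) else 0, fun σ τ => ?_⟩
  rw [hu]
  by_cases h1 : ∀ i ∉ S, σ i = τ i
  · have h2 : ∀ i ∉ S', σ i = τ i := fun i hi => h1 i fun h' => hi (h h')
    have h3 : ∀ i : S', i.1 ∉ S → σ i = τ i := fun i hi => h1 i hi
    rw [if_pos h1]
    exact ((if_pos h2).trans (if_pos h3)).symm
  · rw [if_neg h1]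
    by_cases h2 : ∀ i ∉ S', σ i = τ i
    · refine ((if_pos h2).trans (if_neg fun h3 => h1 fun i hi => ?_)).symm
      by_cases h4 : i ∈ S'
      · exact h3 ⟨i, h4⟩ hi
      · exact h2 i h4
    · exact (if_neg h2).symm

theorem ActsOn.commute {S S' : Finset (Fin L)} (h : Disjoint S S') {M N : Op d L}
    (hM : ActsOn S M) (hN : ActsOn S' N) : Commute M N := by
  obtain ⟨u, rfl⟩ := (actsOn_iff S M).1 hM
  obtain ⟨v, rfl⟩ := localOp_compl_eq S (hN.mono (Finset.subset_compl_iff_disjoint_left.2 h))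
  rw [Commute, SemiconjBy, localOp, Matrix.submatrix_mul_equiv, Matrix.submatrix_mul_equiv,
    ← Matrix.mul_kronecker_mul, ← Matrix.mul_kronecker_mul]
  simp

/-- The normalized trace is multiplicative on disjoint supports; multiplying by `d ^ L` avoids
division. -/
theorem ActsOn.trace_mul {S S' : Finset (Fin L)} (h : Disjoint S S') {M N : Op d L}
    (hM : ActsOn S M) (hN : ActsOn S' N) :
    (d : ℂ) ^ L * (M * N).trace = M.trace * N.trace := by
  obtain ⟨u, rfl⟩ := (actsOn_iff S M).1 hM
  obtain ⟨v, rfl⟩ := localOp_compl_eq S (hN.mono (Finset.subset_compl_iff_disjoint_left.2 h))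
  rw [localOp, Matrix.submatrix_mul_equiv, ← Matrix.mul_kronecker_mul,
    trace_submatrix_splitEquiv, trace_submatrix_splitEquiv, trace_submatrix_splitEquiv,
    Matrix.trace_kronecker, Matrix.trace_kronecker, Matrix.trace_kronecker, mul_one, one_mul,
    Matrix.trace_one, Matrix.trace_one]
  have : (d : ℂ) ^ L = (Fintype.card (S → Fin d) : ℂ) *
      (Fintype.card ((Sᶜ : Finset (Fin L)) → Fin d) : ℂ) := by
    rw [← Nat.cast_mul, ← Fintype.card_prod, ← Fintype.card_congr (splitEquiv d S)]
    simp
  rw [this]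
  ring

theorem trace_localOp (S : Finset (Fin L)) (u : Matrix (S → Fin d) (S → Fin d) ℂ) :
    (d : ℂ) ^ S.card * (localOp S u).trace = (d : ℂ) ^ L * u.trace := by
  have : (d : ℂ) ^ L = (Fintype.card (S → Fin d) : ℂ) *
      (Fintype.card ((Sᶜ : Finset (Fin L)) → Fin d) : ℂ) := by
    rw [← Nat.cast_mul, ← Fintype.card_prod, ← Fintype.card_congr (splitEquiv d S)]
    simp
  rw [this, localOp, trace_submatrix_splitEquiv, Matrix.trace_kronecker, Matrix.trace_one]
  simp only [Fintype.card_pi, Fintype.card_fin, Finset.prod_const, Finset.card_univ,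
    Fintype.card_coe, Nat.cast_pow]
  ring

theorem sum_splitEquiv {α : Type*} [AddCommMonoid α] (S : Finset (Fin L)) (f : Config d L → α) :
    ∑ σ, f σ = ∑ b, ∑ a, f ((splitEquiv d S).symm (a, b)) := by
  rw [← (splitEquiv d S).symm.sum_comp, Fintype.sum_prod_type_right]

theorem localOp_mulVec (S : Finset (Fin L)) (u : Matrix (S → Fin d) (S → Fin d) ℂ)
    (Φ : Config d L → ℂ) (σ : Config d L) :
    (localOp S u *ᵥ Φ) σ =
      ∑ a, u (S.restrict σ) a * Φ ((splitEquiv d S).symm (a, Sᶜ.restrict σ)) := by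
  rw [Matrix.mulVec, dotProduct, sum_splitEquiv S, Finset.sum_eq_single (Sᶜ.restrict σ)]
  · refine Finset.sum_congr rfl fun a _ => ?_
    simp [localOp, splitEquiv_apply]
  · intro b _ hb
    refine Finset.sum_eq_zero fun a _ => ?_
    simp [localOp, splitEquiv_apply, Ne.symm hb]
  · simp

/-! ### States that factorize -/

/-- `Φ` is a product of a state of `A` and a state of its complement. -/
def Factorizes (A : Finset (Fin L)) (Φ : Config d L → ℂ) : Prop :=
  ∀ σ τ, Φ σ * Φ τ = Φ (A.piecewise σ τ) * Φ (A.piecewise τ σ)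

theorem Factorizes.compl {A : Finset (Fin L)} {Φ : Config d L → ℂ} (h : Factorizes A Φ) :
    Factorizes Aᶜ Φ := fun σ τ => by
  rw [Finset.piecewise_compl, Finset.piecewise_compl, h, mul_comm]

theorem Factorizes.smul {A : Finset (Fin L)} {Φ : Config d L → ℂ} (h : Factorizes A Φ) (c : ℂ) :
    Factorizes A (c • Φ) := fun σ τ => by
  simp only [Pi.smul_apply, smul_eq_mul]
  linear_combination c ^ 2 * h σ τ

/-- The factorization identity is linear in each of two copies of the state, so it survives the
application of `u` to both, term by term. -/
theorem Factorizes.mulVec {A : Finset (Fin L)} {Φ : Config d L → ℂ} (h : Factorizes A Φ)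
    {M : Op d L} (hM : ActsOn A M) : Factorizes A (M *ᵥ Φ) := by
  obtain ⟨u, rfl⟩ := (actsOn_iff A M).1 hM
  intro σ τ
  have key : ∀ σ τ, A.restrict (A.piecewise σ τ) = A.restrict σ ∧
      Aᶜ.restrict (A.piecewise σ τ) = Aᶜ.restrict (τ : Config d L) := fun σ τ => by
    rw [← splitEquiv_symm_restrict]
    exact ⟨restrict_splitEquiv_symm _ _ _, restrict_compl_splitEquiv_symm _ _ _⟩
  simp only [localOp_mulVec, key, Finset.sum_mul_sum]
  refine Finset.sum_congr rfl fun a _ => Finset.sum_congr rfl fun b _ => ?_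
  have := h ((splitEquiv d A).symm (a, Aᶜ.restrict σ)) ((splitEquiv d A).symm (b, Aᶜ.restrict τ))
  rw [← splitEquiv_symm_restrict, ← splitEquiv_symm_restrict] at this
  simp only [restrict_splitEquiv_symm, restrict_compl_splitEquiv_symm] at this
  linear_combination u (A.restrict σ) a * u (A.restrict τ) b * this

theorem Factorizes.mulVec_of_compl {A : Finset (Fin L)} {Φ : Config d L → ℂ}
    (h : Factorizes A Φ) {M : Op d L} (hM : ActsOn Aᶜ M) : Factorizes A (M *ᵥ Φ) := by
  simpa using (h.compl.mulVec hM).compl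

/-- This turns cuts at the ends of two long regions into cuts at the ends of their short overlap. A
reference configuration `ω` of nonzero amplitude reduces the two-configuration identity to the case
where one of them is `ω`. -/
theorem Factorizes.inter {A B : Finset (Fin L)} {Φ : Config d L → ℂ} (hA : Factorizes A Φ)
    (hB : Factorizes B Φ) : Factorizes (A ∩ B) Φ := by
  by_cases h0 : Φ = 0
  · intro σ τ; simp [h0]
  obtain ⟨ω, hω⟩ := Function.ne_iff.1 h0
  simp only [Pi.zero_apply] at hω
  -- the amplitude relative to `ω` is multiplicative over the four regions cut out by `A` and `B`
  have key : ∀ σ, Φ σ * Φ ω = Φ ((A ∩ B).piecewise σ ω) * Φ ((A ∩ B).piecewise ω σ) := by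
    intro σ
    have h1 := hA σ ω
    have h2 := hB (A.piecewise σ ω) ω
    have h3 := hA ((A ∩ B).piecewise ω σ) ω
    have e1 : B.piecewise (A.piecewise σ ω) ω = (A ∩ B).piecewise σ ω := by
      ext i; by_cases hA : i ∈ A <;> by_cases hB : i ∈ B <;> simp [Finset.piecewise, hA, hB]
    have e2 : B.piecewise ω (A.piecewise σ ω) = A.piecewise ((A ∩ B).piecewise ω σ) ω := by
      ext i; by_cases hA : i ∈ A <;> by_cases hB : i ∈ B <;> simp [Finset.piecewise, hA, hB]
    have e3 : A.piecewise ω ((A ∩ B).piecewise ω σ) = A.piecewise ω σ := by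
      ext i; by_cases hA : i ∈ A <;> by_cases hB : i ∈ B <;> simp [Finset.piecewise, hA, hB]
    rw [e1, e2] at h2
    rw [e3] at h3
    refine mul_right_cancel₀ hω ?_
    linear_combination Φ ω * h1 + Φ (A.piecewise ω σ) * h2 - Φ ((A ∩ B).piecewise σ ω) * h3
  set C := A ∩ B
  intro σ τ
  have e (σ τ : Config d L) : C.piecewise (C.piecewise σ τ) ω = C.piecewise σ ω ∧
      C.piecewise ω (C.piecewise σ τ) = C.piecewise ω τ := by
    constructor <;> ext i <;> by_cases h : i ∈ C <;> simp [Finset.piecewise, h]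
  have h1 := key (C.piecewise σ τ)
  have h2 := key (C.piecewise τ σ)
  rw [(e _ _).1, (e _ _).2] at h1 h2
  refine mul_right_cancel₀ (mul_ne_zero hω hω) ?_
  linear_combination (Φ τ * Φ ω) * key σ +
    Φ (C.piecewise σ ω) * Φ (C.piecewise ω σ) * key τ -
    Φ (C.piecewise τ σ) * Φ ω * h1 - Φ (C.piecewise σ ω) * Φ (C.piecewise ω τ) * h2

theorem IsBipartiteProduct.factorizes {A : Finset (Fin L)} {Φ : Ket d L}
    (h : IsBipartiteProduct A Φ) : Factorizes A Φ.ofLp := by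
  obtain ⟨a, b, -, -, h⟩ := h
  have key : ∀ σ τ, A.restrict (A.piecewise σ τ) = A.restrict σ ∧
      Aᶜ.restrict (A.piecewise σ τ) = Aᶜ.restrict (τ : Config d L) := fun σ τ => by
    rw [← splitEquiv_symm_restrict]
    exact ⟨restrict_splitEquiv_symm _ _ _, restrict_compl_splitEquiv_symm _ _ _⟩
  intro σ τ
  rw [h, h, h, h]
  simp only [key]
  ring

theorem IsBipartiteProduct.norm_eq_one {A : Finset (Fin L)} {Φ : Ket d L}
    (h : IsBipartiteProduct A Φ) : ‖Φ‖ = 1 := by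
  obtain ⟨a, b, ha, hb, h⟩ := h
  have ha2 := EuclideanSpace.norm_sq_eq a
  have hb2 := EuclideanSpace.norm_sq_eq b
  rw [ha] at ha2
  rw [hb] at hb2
  rw [← sq_eq_sq₀ (norm_nonneg _) zero_le_one, EuclideanSpace.norm_sq_eq, sum_splitEquiv A]
  simp only [h, norm_mul, mul_pow, restrict_splitEquiv_symm, restrict_compl_splitEquiv_symm,
    ← Finset.sum_mul, ← Finset.mul_sum, ← ha2, ← hb2]
  norm_num

theorem norm_toLp_sq {ι : Type*} [Fintype ι] (x : ι → ℂ) :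
    ((‖WithLp.toLp 2 x‖ ^ 2 : ℝ) : ℂ) = star x ⬝ᵥ x := by
  rw [EuclideanSpace.norm_sq_eq, dotProduct, Complex.ofReal_sum]
  refine Finset.sum_congr rfl fun i _ => ?_
  simp [Complex.conj_mul']

theorem norm_toLp_mulVec {ι : Type*} [Fintype ι] [DecidableEq ι] {M : Matrix ι ι ℂ}
    (hM : M ∈ Matrix.unitaryGroup ι ℂ) (x : ι → ℂ) :
    ‖WithLp.toLp 2 (M *ᵥ x)‖ = ‖WithLp.toLp 2 x‖ := by
  rw [← sq_eq_sq₀ (norm_nonneg _) (norm_nonneg _), ← Complex.ofReal_inj, norm_toLp_sq,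
    norm_toLp_sq, Matrix.star_mulVec, Matrix.dotProduct_mulVec, Matrix.vecMul_vecMul,
    ← Matrix.star_eq_conjTranspose, Matrix.mem_unitaryGroup_iff'.1 hM, Matrix.vecMul_one]

/-! ### Translations -/

/-- The operator `M` with its sites relabelled by the permutation `e`. -/
def relabel (e : Equiv.Perm (Fin L)) (M : Op d L) : Op d L :=
  M.submatrix (fun σ => σ ∘ e) (fun σ => σ ∘ e)

/-- Precomposition of configurations with a permutation of the sites. -/
def compEquiv (d : ℕ) (e : Equiv.Perm (Fin L)) : Config d L ≃ Config d L :=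
  e.symm.arrowCongr (Equiv.refl _)

theorem compEquiv_apply (e : Equiv.Perm (Fin L)) (σ : Config d L) : compEquiv d e σ = σ ∘ e := by
  ext i; simp [compEquiv, Equiv.arrowCongr]

theorem relabel_eq (e : Equiv.Perm (Fin L)) (M : Op d L) :
    relabel e M = M.submatrix (compEquiv d e) (compEquiv d e) := by
  ext σ τ; simp [relabel, compEquiv_apply]

theorem relabel_mul (e : Equiv.Perm (Fin L)) (M N : Op d L) :
    relabel e (M * N) = relabel e M * relabel e N := by
  simp only [relabel_eq, Matrix.submatrix_mul_equiv]

theorem relabel_one (e : Equiv.Perm (Fin L)) : relabel e (1 : Op d L) = 1 := by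
  simp [relabel_eq]

theorem relabel_conjTranspose (e : Equiv.Perm (Fin L)) (M : Op d L) :
    relabel e Mᴴ = (relabel e M)ᴴ := rfl

theorem trace_relabel (e : Equiv.Perm (Fin L)) (M : Op d L) :
    (relabel e M).trace = M.trace := by
  rw [relabel_eq]
  exact Fintype.sum_equiv (compEquiv d e) _ _ fun _ => rfl

theorem relabel_mem_unitaryGroup (e : Equiv.Perm (Fin L)) {M : Op d L}
    (hM : M ∈ Matrix.unitaryGroup (Config d L) ℂ) :
    relabel e M ∈ Matrix.unitaryGroup (Config d L) ℂ := by
  rw [Matrix.mem_unitaryGroup_iff, Matrix.star_eq_conjTranspose] at *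
  rw [← relabel_conjTranspose, ← relabel_mul, hM, relabel_one]

theorem relabel_mulVec (e : Equiv.Perm (Fin L)) (M : Op d L) (Φ : Config d L → ℂ) :
    relabel e M *ᵥ (fun σ => Φ (σ ∘ e)) = fun σ => (M *ᵥ Φ) (σ ∘ e) := by
  ext σ
  simp only [Matrix.mulVec, dotProduct, relabel, Matrix.submatrix_apply]
  exact Fintype.sum_equiv (compEquiv d e) _ _ fun τ => by rw [compEquiv_apply]

theorem ActsOn.relabel {S : Finset (Fin L)} {M : Op d L} (h : ActsOn S M)
    (e : Equiv.Perm (Fin L)) : ActsOn (S.map e.toEmbedding) (relabel e M) := by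
  obtain ⟨u, hu⟩ := h
  have hm : ∀ i : S, e i ∈ S.map e.toEmbedding := fun i => by simp
  refine ⟨u.submatrix (fun a i => a ⟨e i, hm i⟩) (fun a i => a ⟨e i, hm i⟩), fun σ τ => ?_⟩
  have h1 : (∀ i ∉ S, σ (e i) = τ (e i)) ↔ ∀ i ∉ S.map e.toEmbedding, σ i = τ i := by
    constructor
    · intro h i hi
      have := h (e.symm i) fun h' => hi (by simpa using h')
      simpa using this
    · intro h i hi
      exact h (e i) (by simpa using hi)
  simp only [TranslationMMIS.relabel, Matrix.submatrix_apply, hu, Function.comp_apply, h1]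
  rfl

theorem Factorizes.relabel {A : Finset (Fin L)} {Φ : Config d L → ℂ} (h : Factorizes A Φ)
    (e : Equiv.Perm (Fin L)) :
    Factorizes (A.map e.toEmbedding) fun σ => Φ (σ ∘ e) := by
  have key (σ τ : Config d L) :
      (A.map e.toEmbedding).piecewise σ τ ∘ e = A.piecewise (σ ∘ e) (τ ∘ e) := by
    ext i; by_cases hi : i ∈ A <;> simp [Finset.piecewise, hi]
  intro σ τ
  simp only [key]
  exact h _ _

theorem translation_mulVec (Φ : Config d L → ℂ) :
    translation d L *ᵥ Φ = fun σ => Φ (σ ∘ finRotate L) := by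
  ext σ
  simp [Matrix.mulVec, dotProduct, translation]

theorem translation_pow_mulVec (n : ℕ) (Φ : Config d L → ℂ) :
    translation d L ^ n *ᵥ Φ = fun σ => Φ (σ ∘ ⇑(finRotate L ^ n)) := by
  induction n with
  | zero => ext σ; simp
  | succ n ih =>
    rw [pow_succ', ← Matrix.mulVec_mulVec, ih, translation_mulVec, pow_succ']
    rfl

/-- A state with definite momentum changes by a nonzero factor under translation by `n` sites. -/
theorem IsTranslationSymmetric.exists_ne_zero {Ψ : Ket d L} (h : IsTranslationSymmetric Ψ)
    (n : ℕ) : ∃ c : ℂ, c ≠ 0 ∧ (fun σ => Ψ.ofLp (σ ∘ ⇑(finRotate L ^ n))) = c • Ψ.ofLp := by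
  by_cases h0 : Ψ.ofLp = 0
  · exact ⟨1, one_ne_zero, by ext σ; simp [h0]⟩
  obtain ⟨c, hc⟩ := h
  have hc0 : c ≠ 0 := by
    rintro rfl
    rw [translation_mulVec, zero_smul] at hc
    refine h0 (funext fun σ => ?_)
    -- Translation is a bijection on configurations, so the eigenvalue zero would kill every
    -- amplitude.
    have := congrFun hc (σ ∘ (finRotate L).symm)
    simpa [Function.comp_assoc] using this
  refine ⟨c ^ n, pow_ne_zero _ hc0, ?_⟩
  rw [← translation_pow_mulVec]
  induction n with
  | zero => simp
  | succ n ih => 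
    rw [pow_succ' (translation d L), ← Matrix.mulVec_mulVec, ih, Matrix.mulVec_smul, hc,
      smul_smul]
    exact congrArg (· • Ψ.ofLp) (pow_succ c n).symm

/-! ### Contiguous regions of the ring -/

/-- The region `a, a + 1, …, a + n - 1` (mod `L`) of the ring, for an integer `a`. -/
def seg (L : ℕ) (a : ℤ) (n : ℕ) : Finset (Fin L) :=
  Finset.univ.filter fun i => ((i : ℤ) - a) % L < n

/-- Lifting a site of the ring to an integer representative `i + k * L` turns statements about
segments into linear inequalities. -/
theorem mem_seg {a : ℤ} {n : ℕ} {i : Fin L} :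
    i ∈ seg L a n ↔ ∃ k : ℤ, a ≤ i + k * L ∧ i + k * L < a + n := by
  have hL : (0 : ℤ) < L := by have := i.pos; omega
  simp only [seg, Finset.mem_filter, Finset.mem_univ, true_and]
  constructor
  · intro h
    refine ⟨-(((i : ℤ) - a) / L), ?_⟩
    have h1 := Int.emod_add_mul_ediv ((i : ℤ) - a) L
    have h2 := Int.emod_nonneg ((i : ℤ) - a) hL.ne'
    constructor <;> linarith
  · rintro ⟨k, h1, h2⟩
    have h3 : ((i : ℤ) - a) % L = ((i : ℤ) - a + k * L) % L := by simp
    have h4 := Int.emod_add_mul_ediv ((i : ℤ) - a + k * L) L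
    have h5 : 0 ≤ (L : ℤ) * (((i : ℤ) - a + k * L) / L) :=
      mul_nonneg hL.le (Int.ediv_nonneg (by linarith) hL.le)
    linarith

theorem exists_site (hL : 0 < L) (z : ℤ) : ∃ (i : Fin L) (k : ℤ), (i : ℤ) + k * L = z := by
  have hL' : (0 : ℤ) < L := by omega
  have h1 := Int.emod_nonneg z hL'.ne'
  have h2 := Int.emod_lt_of_pos z hL'
  refine ⟨⟨(z % L).toNat, by omega⟩, z / L, ?_⟩
  have := Int.emod_add_mul_ediv z L
  simp only [Int.toNat_of_nonneg h1]
  linarith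

theorem seg_subset {a b : ℤ} {n m : ℕ} (h1 : b ≤ a) (h2 : a + n ≤ b + m) :
    seg L a n ⊆ seg L b m := fun i hi => by
  obtain ⟨k, h3, h4⟩ := mem_seg.1 hi
  exact mem_seg.2 ⟨k, by omega, by omega⟩

theorem seg_add_period (a : ℤ) (n : ℕ) : seg L (a + L) n = seg L a n := by
  ext i
  simp only [mem_seg]
  constructor
  · rintro ⟨k, h1, h2⟩; exact ⟨k - 1, by linarith, by linarith⟩
  · rintro ⟨k, h1, h2⟩; exact ⟨k + 1, by linarith, by linarith⟩

theorem seg_add_int_mul (a j : ℤ) (n : ℕ) : seg L (a + j * L) n = seg L a n := by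
  ext i
  simp only [mem_seg]
  constructor
  · rintro ⟨k, h1, h2⟩; exact ⟨k - j, by linarith, by linarith⟩
  · rintro ⟨k, h1, h2⟩; exact ⟨k + j, by linarith, by linarith⟩

theorem seg_disjoint {a b : ℤ} {n m : ℕ} (h1 : a + n ≤ b) (h2 : b + m ≤ a + L) :
    Disjoint (seg L a n) (seg L b m) := by
  rw [Finset.disjoint_left]
  intro i hi hj
  obtain ⟨k, h3, h4⟩ := mem_seg.1 hi
  obtain ⟨l, h5, h6⟩ := mem_seg.1 hj
  have hL : (0 : ℤ) < L := by have := i.pos; omega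
  -- The two lifts of a common site would differ by a multiple of `L` strictly between `0` and `L`.
  have h7 : (0 : ℤ) * L < (l - k) * L := by linarith
  have h8 : (l - k) * L < (1 : ℤ) * L := by linarith
  have := lt_of_mul_lt_mul_right h7 hL.le
  have := lt_of_mul_lt_mul_right h8 hL.le
  omega

theorem seg_compl {a : ℤ} {n : ℕ} (hn : n ≤ L) : (seg L a n)ᶜ = seg L (a + n) (L - n) := by
  ext i
  rw [Finset.mem_compl]
  constructor
  · intro h
    have hL : (0 : ℤ) < L := by have := i.pos; omega
    have h1 := Int.emod_add_mul_ediv ((i : ℤ) - a) L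
    have h2 := Int.emod_nonneg ((i : ℤ) - a) hL.ne'
    have h3 := Int.emod_lt_of_pos ((i : ℤ) - a) hL
    simp only [seg, Finset.mem_filter, Finset.mem_univ, true_and, not_lt] at h
    refine mem_seg.2 ⟨-(((i : ℤ) - a) / L), by linarith, ?_⟩
    rw [Nat.cast_sub hn]
    linarith
  · intro h h'
    exact Finset.disjoint_left.1 (seg_disjoint (a := a) (n := n) (b := a + n) (m := L - n) le_rfl
      (by omega)) h' h

/-- The bound `s + n ≤ L` keeps the shifted segment from wrapping around onto the first `s` sites.
-/
theorem seg_inter_compl_seg {x : ℤ} {n s : ℕ} (h1 : s ≤ n) (h2 : s + n ≤ L) :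
    seg L x n ∩ (seg L (x + s) n)ᶜ = seg L x s := by
  ext i
  rw [Finset.mem_inter]
  constructor
  · rintro ⟨h3, h4⟩
    obtain ⟨k, h5, h6⟩ := mem_seg.1 h3
    refine mem_seg.2 ⟨k, h5, ?_⟩
    by_contra h7
    exact Finset.mem_compl.1 h4 (mem_seg.2 ⟨k, by linarith, by omega⟩)
  · intro h
    refine ⟨seg_subset le_rfl (by omega) h, ?_⟩
    rw [Finset.mem_compl]
    exact Finset.disjoint_left.1 (seg_disjoint le_rfl (by omega)) h

theorem subset_of_not_disjoint_seg {a b : ℤ} {n m r : ℕ} (hm : m ≤ r)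
    (h : ¬Disjoint (seg L b m) (seg L a n)) : seg L b m ⊆ seg L (a - r) (n + 2 * r) := by
  obtain ⟨i, hi, hj⟩ := Finset.not_disjoint_iff.1 h
  obtain ⟨k, h3, h4⟩ := mem_seg.1 hi
  obtain ⟨l, h5, h6⟩ := mem_seg.1 hj
  rw [← seg_add_int_mul b (l - k)]
  apply seg_subset
  · linarith
  · push_cast; linarith

/-- A contiguous region that contains neither of the two bonds between a contiguous region and its
complement lies on one side. -/
theorem subset_or_subset_compl_of_disjoint {x b : ℤ} {n m : ℕ} (hn : n ≤ L)
    (hx : Disjoint (seg L b m) (seg L (x - 1) 2))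
    (hy : Disjoint (seg L b m) (seg L (x + n - 1) 2)) :
    seg L b m ⊆ seg L x n ∨ seg L b m ⊆ (seg L x n)ᶜ := by
  rcases Nat.eq_zero_or_pos L with rfl | hL
  · left; intro i; exact i.elim0
  have hL' : (0 : ℤ) < L := by omega
  wlog hb : x ≤ b ∧ b < x + L generalizing b
  · have h1 := Int.emod_add_mul_ediv (b - x) L
    have h2 := Int.emod_nonneg (b - x) hL'.ne'
    have h3 := Int.emod_lt_of_pos (b - x) hL'
    have h4 := seg_add_int_mul (L := L) b (-((b - x) / L)) m
    rw [← h4] at hx hy ⊢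
    exact this hx hy ⟨by linarith, by linarith⟩
  rcases Nat.eq_zero_or_pos m with rfl | hm
  · left
    intro i hi
    obtain ⟨k, h1, h2⟩ := mem_seg.1 hi
    omega
  rcases lt_or_ge b (x + n) with h | h
  · left
    refine seg_subset hb.1 ?_
    by_contra h3
    -- A segment that starts inside and overshoots contains the last site `x + n - 1` of the region,
    -- which belongs to the forbidden bond.
    obtain ⟨i, k, hk⟩ := exists_site hL (x + n - 1)
    have h1 : i ∈ seg L b m := mem_seg.2 ⟨k, by omega, by omega⟩
    exact Finset.disjoint_left.1 hy h1 (mem_seg.2 ⟨k, by omega, by omega⟩)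
  · right
    rw [seg_compl hn]
    refine seg_subset h ?_
    by_contra h3
    obtain ⟨i, k, hk⟩ := exists_site hL (x + L - 1)
    have h1 : i ∈ seg L b m := mem_seg.2 ⟨k, by omega, by omega⟩
    exact Finset.disjoint_left.1 hx h1 (mem_seg.2 ⟨k - 1, by linarith, by push_cast; linarith⟩)

theorem val_finRotate_pow (k : ℕ) (i : Fin L) :
    ((finRotate L ^ k) i : ℕ) = (i + k) % L := by
  induction k with
  | zero => simp [Nat.mod_eq_of_lt i.2]
  | succ k ih =>
    rw [pow_succ', Equiv.Perm.mul_apply]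
    have := i.neZero
    rw [finRotate_apply, Fin.val_add, ih]
    simp [← add_assoc]

theorem finRotate_pow_self (L : ℕ) : finRotate L ^ L = 1 := by
  ext i
  simp [val_finRotate_pow, Nat.mod_eq_of_lt i.2]

theorem seg_map_finRotate_pow (a : ℤ) (n k : ℕ) :
    (seg L a n).map (finRotate L ^ k).toEmbedding = seg L (a + k) n := by
  ext i
  simp only [Finset.mem_map, Equiv.coe_toEmbedding]
  constructor
  · rintro ⟨j, hj, rfl⟩
    obtain ⟨l, h1, h2⟩ := mem_seg.1 hj
    have h3 := Int.emod_add_mul_ediv ((j : ℤ) + k) L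
    refine mem_seg.2 ⟨l + ((j : ℤ) + k) / L, ?_⟩
    rw [val_finRotate_pow]
    push_cast
    constructor <;> linarith
  · intro hi
    obtain ⟨l, h1, h2⟩ := mem_seg.1 hi
    obtain ⟨j, hj⟩ := (finRotate L ^ k).surjective i
    refine ⟨j, ?_, hj⟩
    have h3 := Int.emod_add_mul_ediv ((j : ℤ) + k) L
    rw [← hj, val_finRotate_pow] at h1 h2
    push_cast at h1 h2
    refine mem_seg.2 ⟨l - ((j : ℤ) + k) / L, ?_⟩
    constructor <;> linarith

theorem arc_eq_seg (i : Fin L) (n : ℕ) : arc i n = seg L i n := by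
  ext j
  simp only [arc, Finset.mem_image, Finset.mem_range, mem_seg]
  constructor
  · rintro ⟨k, hk, rfl⟩
    have h3 := Int.emod_add_mul_ediv ((i : ℤ) + k) L
    refine ⟨((i : ℤ) + k) / L, ?_⟩
    rw [val_finRotate_pow]
    push_cast
    constructor <;> linarith
  · rintro ⟨k, h1, h2⟩
    refine ⟨((j : ℤ) + k * L - i).toNat, by omega, Fin.ext ?_⟩
    rw [val_finRotate_pow]
    have h3 : ((i + ((j : ℤ) + k * L - i).toNat : ℕ) : ℤ) = j + k * L := by
      push_cast
      omega
    have h4 : ((j : ℤ) + k * L) % L = j := by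
      rw [Int.add_mul_emod_self_right]
      exact Int.emod_eq_of_lt (by omega) (by have := j.2; omega)
    rw [← Int.ofNat_inj, Int.natCast_mod, h3, h4]

theorem card_arc {i : Fin L} {n : ℕ} (hn : n ≤ L) : (arc i n).card = n := by
  rw [arc, Finset.card_image_of_injOn, Finset.card_range]
  intro k hk l hl h
  simp only [Finset.coe_range, Set.mem_Iio] at hk hl
  have h1 : ((i + k) % L : ℕ) = (i + l) % L := by
    rw [← val_finRotate_pow, ← val_finRotate_pow]
    exact congrArg Fin.val h
  have h2 : k ≡ l [MOD L] := Nat.ModEq.add_left_cancel' (i : ℕ) h1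
  rwa [Nat.ModEq, Nat.mod_eq_of_lt (by omega), Nat.mod_eq_of_lt (by omega)] at h2

theorem exists_seg_eq_arc (hL : 0 < L) (a : ℤ) : ∃ i : Fin L, ∀ n, seg L a n = arc i n := by
  obtain ⟨i, k, rfl⟩ := exists_site hL a
  exact ⟨i, fun n => by rw [arc_eq_seg, seg_add_int_mul]⟩

theorem card_seg (hL : 0 < L) (a : ℤ) {n : ℕ} (hn : n ≤ L) : (seg L a n).card = n := by
  obtain ⟨i, hi⟩ := exists_seg_eq_arc hL a
  rw [hi, card_arc hn]

theorem isArc_seg (hL : 0 < L) (a : ℤ) (n : ℕ) : IsArc (seg L a n) := by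
  obtain ⟨i, hi⟩ := exists_seg_eq_arc hL a
  exact ⟨i, n, hi n⟩

theorem card_seg_le (hL : 0 < L) (a : ℤ) (n : ℕ) : (seg L a n).card ≤ n := by
  obtain ⟨i, hi⟩ := exists_seg_eq_arc hL a
  rw [hi]
  exact Finset.card_image_le.trans (by simp)

theorem IsArc.exists_seg {S : Finset (Fin L)} (h : IsArc S) :
    0 < L ∧ ∃ (x : ℕ) (n : ℕ), n ≤ L ∧ S = seg L x n ∧ S.card = n := by
  obtain ⟨i, n, rfl⟩ := h
  refine ⟨i.pos, i, ?_⟩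
  rcases le_total n L with hn | hn
  · exact ⟨n, hn, arc_eq_seg i n, card_arc hn⟩
  · have h1 : (arc i L).card = L := card_arc le_rfl
    have h2 : arc i L = Finset.univ := Finset.eq_univ_of_card _ (by simpa using h1)
    have h3 : arc i n = arc i L := by
      rw [h2, ← Finset.univ_subset_iff, ← h2, arc_eq_seg, arc_eq_seg]
      exact seg_subset le_rfl (by omega)
    exact ⟨L, le_rfl, by rw [h3, arc_eq_seg], by rw [h3, h1]⟩

/-! ### Light cones of circuits -/

theorem prod_map_filter_mul_of_commute {M ι : Type*} [Monoid M] (f : ι → M) (p : ι → Prop)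
    [DecidablePred p] (l : List ι) (h : l.Pairwise fun i j => Commute (f i) (f j)) :
    (l.map f).prod = ((l.filter (p ·)).map f).prod * ((l.filter (¬p ·)).map f).prod := by
  induction l with
  | nil => simp
  | cons a l ih =>
    rw [List.pairwise_cons] at h
    rw [List.map_cons, List.prod_cons, ih h.2]
    by_cases hp : p a
    · simp [hp, mul_assoc]
    · have hc : Commute (f a) ((l.filter (p ·)).map f).prod := by
        refine Commute.list_prod_right _ _ fun x hx => ?_
        obtain ⟨i, hi, rfl⟩ := List.mem_map.1 hx
        exact h.1 i (List.mem_of_mem_filter hi)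
      rw [← mul_assoc, hc.eq]
      simp [hp, mul_assoc]

theorem ActsOn.list_prod {S : Finset (Fin L)} {l : List (Op d L)} (h : ∀ M ∈ l, ActsOn S M) :
    ActsOn S l.prod := by
  induction l with
  | nil => exact ActsOn.one S
  | cons a l ih =>
    rw [List.prod_cons]
    exact (h a (by simp)).mul (ih fun M hM => h M (by simp [hM]))

theorem Factorizes.list_prod_mulVec {A : Finset (Fin L)} {Φ : Config d L → ℂ}
    (hΦ : Factorizes A Φ) {l : List (Op d L)} (h : ∀ M ∈ l, ActsOn A M ∨ ActsOn Aᶜ M) :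
    Factorizes A (l.prod *ᵥ Φ) := by
  induction l with
  | nil => simpa
  | cons a l ih =>
    rw [List.prod_cons, ← Matrix.mulVec_mulVec]
    have := ih fun M hM => h M (by simp [hM])
    rcases h a (by simp) with h1 | h1
    · exact this.mulVec h1
    · exact this.mulVec_of_compl h1

theorem IsLocalLayer.mem_unitaryGroup {r : ℕ} {M : Op d L} (h : IsLocalLayer r M) :
    M ∈ Matrix.unitaryGroup (Config d L) ℂ := by
  obtain ⟨n, S, G, -, -, h3, rfl⟩ := h
  refine Submonoid.list_prod_mem _ fun x hx => ?_
  obtain ⟨i, rfl⟩ := List.mem_ofFn.1 hx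
  exact (h3 i).1

theorem IsLocalCircuit.mem_unitaryGroup {D r : ℕ} {U : Op d L} (h : IsLocalCircuit D r U) :
    U ∈ Matrix.unitaryGroup (Config d L) ℂ := by
  obtain ⟨l, h1, rfl⟩ := h
  refine Submonoid.list_prod_mem _ fun x hx => ?_
  obtain ⟨i, rfl⟩ := List.mem_ofFn.1 hx
  exact (h1 i).mem_unitaryGroup

/-- A layer splits into the gates that touch a neighbourhood of a first bond, those that touch a
neighbourhood of a second one, and the others. -/
theorem IsLocalLayer.exists_split {r : ℕ} {M : Op d L} (h : IsLocalLayer r M) {x : ℤ} {n w : ℕ}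
    (hn : n ≤ L) (hw : 1 ≤ w) :
    ∃ Mx My R : Op d L, M = Mx * My * R ∧
      Mx ∈ Matrix.unitaryGroup (Config d L) ℂ ∧ My ∈ Matrix.unitaryGroup (Config d L) ℂ ∧
      ActsOn (seg L (x - (w + r : ℕ)) (2 * (w + r))) Mx ∧
      ActsOn (seg L (x + n - (w + r : ℕ)) (2 * (w + r))) My ∧
      ActsOn (seg L (x - w) (2 * w))ᶜ My ∧
      ActsOn (seg L (x - w) (2 * w))ᶜ R ∧ ActsOn (seg L (x + n - w) (2 * w))ᶜ R ∧
      ∀ Φ, Factorizes (seg L x n) Φ → Factorizes (seg L x n) (R *ᵥ Φ) := by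
  classical
  obtain ⟨N, S, G, h1, h2, h3, rfl⟩ := h
  have hS : ∀ k, ∃ (b : ℤ) (m : ℕ), m ≤ r ∧ S k = seg L b m := fun k => by
    obtain ⟨-, b, m, -, hb, hc⟩ := (h2 k).1.exists_seg
    exact ⟨b, m, hc ▸ (h2 k).2, hb⟩
  set X := seg L (x - w) (2 * w) with hX
  set Y := seg L (x + n - w) (2 * w) with hY
  let p : Fin N → Prop := fun k => ¬Disjoint (S k) X
  let q : Fin N → Prop := fun k => ¬Disjoint (S k) Y
  have hcomm : ∀ l : List (Fin N), l.Nodup → l.Pairwise fun i j => Commute (G i) (G j) :=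
    fun l hl => hl.imp fun {i j} hij => (h3 i).2.commute (h1 i j hij) (h3 j).2
  have hcompl : ∀ k (Z : Finset (Fin L)), Disjoint (S k) Z → ActsOn Zᶜ (G k) := fun k Z hk =>
    (h3 k).2.mono (Finset.subset_compl_iff_disjoint_right.2 hk)
  have hgrow : ∀ k (z : ℤ), ¬Disjoint (S k) (seg L (z - w) (2 * w)) →
      ActsOn (seg L (z - (w + r : ℕ)) (2 * (w + r))) (G k) := fun k z hk => by
    obtain ⟨b, m, hm, hb⟩ := hS k
    refine (h3 k).2.mono ?_
    rw [hb] at hk ⊢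
    refine (subset_of_not_disjoint_seg hm hk).trans (seg_subset ?_ ?_) <;> push_cast <;> linarith
  -- `l1` touches the first window, `l3` only the second, `l4` neither. A gate that touches both is
  -- put in `l1`, so `My` avoids the first window.
  set l1 := (List.finRange N).filter (p ·)
  set l2 := (List.finRange N).filter (¬p ·) with hl2
  have nd2 : l2.Nodup := (List.nodup_finRange N).filter _
  set l3 := l2.filter (q ·) with hl3
  set l4 := l2.filter (¬q ·) with hl4
  have m1 : ∀ k ∈ l1, p k := fun k hk => by simpa using List.of_mem_filter hk
  have m2 : ∀ k ∈ l2, ¬p k := fun k hk => by simpa using List.of_mem_filter hk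
  have m3 : ∀ k ∈ l3, q k ∧ ¬p k := fun k hk =>
    ⟨by simpa using List.of_mem_filter hk, m2 k (List.mem_of_mem_filter hk)⟩
  have m4 : ∀ k ∈ l4, ¬q k ∧ ¬p k := fun k hk =>
    ⟨by simpa using List.of_mem_filter hk, m2 k (List.mem_of_mem_filter hk)⟩
  have hu : ∀ l : List (Fin N), (l.map G).prod ∈ Matrix.unitaryGroup (Config d L) ℂ := fun l => by
    refine Submonoid.list_prod_mem _ fun y hy => ?_
    obtain ⟨k, -, rfl⟩ := List.mem_map.1 hy
    exact (h3 k).1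
  have ha : ∀ (l : List (Fin N)) (Z : Finset (Fin L)), (∀ k ∈ l, ActsOn Z (G k)) →
      ActsOn Z (l.map G).prod := fun l Z hl => by
    refine ActsOn.list_prod fun y hy => ?_
    obtain ⟨k, hk, rfl⟩ := List.mem_map.1 hy
    exact hl k hk
  refine ⟨(l1.map G).prod, (l3.map G).prod, (l4.map G).prod, ?_, hu _, hu _,
    ha _ _ fun k hk => hgrow k x (m1 k hk), ha _ _ fun k hk => hgrow k (x + n) (m3 k hk).1,
    ha _ _ fun k hk => hcompl k _ (not_not.1 (m3 k hk).2),
    ha _ _ fun k hk => hcompl k _ (not_not.1 (m4 k hk).2),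
    ha _ _ fun k hk => hcompl k _ (not_not.1 (m4 k hk).1), fun Φ hΦ => ?_⟩
  · rw [List.ofFn_eq_map, prod_map_filter_mul_of_commute G p _ (hcomm _ (List.nodup_finRange N)),
      mul_assoc, prod_map_filter_mul_of_commute G q l2 (hcomm _ nd2)]
  · refine hΦ.list_prod_mulVec fun y hy => ?_
    obtain ⟨k, hk, rfl⟩ := List.mem_map.1 hy
    obtain ⟨b, m, hm, hb⟩ := hS k
    have hx := not_not.1 (m4 k hk).2
    have hy := not_not.1 (m4 k hk).1
    have hk' := (h3 k).2
    rw [hb] at hx hy hk'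
    -- Since `w ≥ 1`, the windows contain both sites of each boundary bond, so every remaining gate
    -- lies on one side of the cut.
    have := subset_or_subset_compl_of_disjoint hn
      (hx.mono_right (seg_subset (a := x - 1) (n := 2) (by omega) (by push_cast; omega)))
      (hy.mono_right (seg_subset (a := x + n - 1) (n := 2) (by omega) (by push_cast; omega)))
    exact this.imp (fun h => hk'.mono h) fun h => hk'.mono h

/-- A circuit acts across the two ends of a contiguous region only through unitaries of the
light cones of these ends. -/
theorem IsLocalCircuit.exists_split {D r : ℕ} {U : Op d L} (h : IsLocalCircuit D r U) {x : ℤ}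
    {n : ℕ} (hn : n ≤ L) :
    ∃ Cx Cy R : Op d L, U = Cx * Cy * R ∧
      Cx ∈ Matrix.unitaryGroup (Config d L) ℂ ∧ Cy ∈ Matrix.unitaryGroup (Config d L) ℂ ∧
      ActsOn (seg L (x - (1 + D * r : ℕ)) (2 * (1 + D * r))) Cx ∧
      ActsOn (seg L (x + n - (1 + D * r : ℕ)) (2 * (1 + D * r))) Cy ∧
      ∀ Φ, Factorizes (seg L x n) Φ → Factorizes (seg L x n) (R *ᵥ Φ) := by
  induction D generalizing U with
  | zero =>
    obtain ⟨l, -, rfl⟩ := h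
    exact ⟨1, 1, 1, by simp, one_mem _, one_mem _, ActsOn.one _, ActsOn.one _, by simp⟩
  | succ D ih =>
    obtain ⟨l, h1, rfl⟩ := h
    rw [List.ofFn_succ, List.prod_cons]
    obtain ⟨Cx, Cy, R, h2, h3, h4, h5, h6, h7⟩ := ih ⟨fun k => l k.succ, fun k => h1 _, rfl⟩
    -- The window is the light cone of the other `D` layers. Gates of the leftmost layer that miss
    -- it commute with `Cx` and `Cy` and join the remainder; those that touch it widen it by `r`.
    obtain ⟨Mx, My, Q, g1, g2, g3, g4, g5, g6, g7, g8, g9⟩ :=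
      (h1 0).exists_split (x := x) hn (w := 1 + D * r) (by omega)
    have e : 1 + (D + 1) * r = 1 + D * r + r := by ring
    have hsub : ∀ z : ℤ, seg L (z - (1 + D * r : ℕ)) (2 * (1 + D * r)) ⊆
        seg L (z - (1 + D * r + r : ℕ)) (2 * (1 + D * r + r)) := fun z =>
      seg_subset (by push_cast; linarith) (by push_cast; linarith)
    rw [e]
    refine ⟨Mx * Cx, My * Cy, Q * R, ?_, mul_mem g2 h3, mul_mem g3 h4, g4.mul (h5.mono (hsub _)),
      g5.mul (h6.mono (hsub _)), fun Φ hΦ => ?_⟩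
    · have c1 : Q * Cx = Cx * Q := (g7.commute disjoint_compl_left h5).eq
      have c2 : Q * Cy = Cy * Q := (g8.commute disjoint_compl_left h6).eq
      have c3 : My * Cx = Cx * My := (g6.commute disjoint_compl_left h5).eq
      rw [h2, g1]
      calc Mx * My * Q * (Cx * Cy * R) = Mx * My * (Q * Cx) * Cy * R := by noncomm_ring
        _ = Mx * (My * Cx) * (Q * Cy) * R := by rw [c1]; noncomm_ring
        _ = Mx * Cx * (My * Cy) * (Q * R) := by rw [c2, c3]; noncomm_ring
    · rw [← Matrix.mulVec_mulVec]
      exact g9 _ (h7 _ hΦ)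

theorem IsCircuitOfBipartiteProduct.norm_eq_one {D r : ℕ} {A : Finset (Fin L)} {Ψ : Ket d L}
    (h : IsCircuitOfBipartiteProduct D r A Ψ) : ‖Ψ‖ = 1 := by
  obtain ⟨U, Φ, h1, h2, h3⟩ := h
  rw [← h2.norm_eq_one]
  have := norm_toLp_mulVec h1.mem_unitaryGroup Φ.ofLp
  rwa [← h3] at this

theorem conjTranspose_mem_unitaryGroup {ι : Type*} [Fintype ι] [DecidableEq ι] {M : Matrix ι ι ℂ}
    (h : M ∈ Matrix.unitaryGroup ι ℂ) : Mᴴ ∈ Matrix.unitaryGroup ι ℂ :=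
  Unitary.star_mem h

theorem conjTranspose_mul_self_of_mem {ι : Type*} [Fintype ι] [DecidableEq ι] {M : Matrix ι ι ℂ}
    (h : M ∈ Matrix.unitaryGroup ι ℂ) : Mᴴ * M = 1 := Matrix.mem_unitaryGroup_iff'.1 h

theorem mul_conjTranspose_self_of_mem {ι : Type*} [Fintype ι] [DecidableEq ι] {M : Matrix ι ι ℂ}
    (h : M ∈ Matrix.unitaryGroup ι ℂ) : M * Mᴴ = 1 := Matrix.mem_unitaryGroup_iff.1 h

/-- A state `U |A⟩|B⟩` is disentangled by unitaries near the two ends of the region `A`. -/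
theorem IsCircuitOfBipartiteProduct.exists_disentangler {D r : ℕ} {x : ℤ} {n : ℕ} {Ψ : Ket d L}
    (h : IsCircuitOfBipartiteProduct D r (seg L x n) Ψ) (hn : n ≤ L) :
    ∃ C C' : Op d L,
      C ∈ Matrix.unitaryGroup (Config d L) ℂ ∧ C' ∈ Matrix.unitaryGroup (Config d L) ℂ ∧
      ActsOn (seg L (x - (1 + D * r : ℕ)) (2 * (1 + D * r))) C ∧
      ActsOn (seg L (x + n - (1 + D * r : ℕ)) (2 * (1 + D * r))) C' ∧
      Factorizes (seg L x n) ((C' * C) *ᵥ Ψ.ofLp) := by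
  obtain ⟨U, Φ, h1, h2, h3⟩ := h
  obtain ⟨Cx, Cy, R, g1, g2, g3, g4, g5, g6⟩ := h1.exists_split (x := x) hn
  refine ⟨Cxᴴ, Cyᴴ, conjTranspose_mem_unitaryGroup g2, conjTranspose_mem_unitaryGroup g3,
    g4.conjTranspose, g5.conjTranspose, ?_⟩
  have : Cyᴴ * Cxᴴ * U = R := by
    rw [g1]
    calc Cyᴴ * Cxᴴ * (Cx * Cy * R) = Cyᴴ * (Cxᴴ * Cx) * Cy * R := by noncomm_ring
      _ = (Cyᴴ * Cy) * R := by rw [conjTranspose_mul_self_of_mem g2]; noncomm_ring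
      _ = R := by rw [conjTranspose_mul_self_of_mem g3, one_mul]
  rw [h3, Matrix.mulVec_mulVec, this]
  exact g6 _ h2.factorizes

/-! ### Translation-symmetric states with two distant cuts -/

theorem relabel_finRotate_pow_add (k l : ℕ) (M : Op d L) :
    relabel (finRotate L ^ k) (relabel (finRotate L ^ l) M) =
      relabel (finRotate L ^ (k + l)) M := by
  rw [pow_add]
  rfl

theorem ActsOn.relabel_seg {a : ℤ} {n : ℕ} {M : Op d L} (h : ActsOn (seg L a n) M) (k : ℕ) :
    ActsOn (seg L (a + k) n) (TranslationMMIS.relabel (finRotate L ^ k) M) := by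
  rw [← seg_map_finRotate_pow]
  exact h.relabel _

/-- An equation `M Ψ = Φ` and its translates, for a translation-symmetric `Ψ`. -/
theorem IsTranslationSymmetric.exists_relabel_mulVec {Ψ : Ket d L}
    (h : IsTranslationSymmetric Ψ) (k : ℕ) (M : Op d L) : ∃ c : ℂ,
      relabel (finRotate L ^ k) M *ᵥ Ψ.ofLp =
        c • fun σ => (M *ᵥ Ψ.ofLp) (σ ∘ ⇑(finRotate L ^ k)) := by
  obtain ⟨c, hc, h⟩ := h.exists_ne_zero k
  refine ⟨c⁻¹, ?_⟩
  rw [← relabel_mulVec, h, Matrix.mulVec_smul, smul_smul, inv_mul_cancel₀ hc, one_smul]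

theorem IsTranslationSymmetric.factorizes_relabel {Ψ : Ket d L} (h : IsTranslationSymmetric Ψ)
    {a : ℤ} {n : ℕ} {M : Op d L} (hM : Factorizes (seg L a n) (M *ᵥ Ψ.ofLp)) (k : ℕ) :
    Factorizes (seg L (a + k) n) (relabel (finRotate L ^ k) M *ᵥ Ψ.ofLp) := by
  obtain ⟨c, hc⟩ := h.exists_relabel_mulVec k M
  rw [hc, ← seg_map_finRotate_pow]
  exact (hM.relabel _).smul c

/-- If a translation-symmetric state is cut by unitaries near the ends of a long region, then it is
cut at any two sites at a moderate distance by translates of one and the same unitary. -/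
theorem IsTranslationSymmetric.factorizes_seg {Ψ : Ket d L} (hΨ : IsTranslationSymmetric Ψ)
    {x : ℤ} {n w s : ℕ} {C C' : Op d L}
    (hC' : C' ∈ Matrix.unitaryGroup (Config d L) ℂ)
    (aC : ActsOn (seg L (x - w) (2 * w)) C) (aC' : ActsOn (seg L (x + n - w) (2 * w)) C')
    (hF : Factorizes (seg L x n) ((C' * C) *ᵥ Ψ.ofLp))
    (hn : 6 * w ≤ n) (hnL : n + 6 * w ≤ L) (hs : 2 * w ≤ s) (hs' : s ≤ 4 * w) (k : ℕ) :
    Factorizes (seg L (x + k) s)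
      ((relabel (finRotate L ^ (k + s)) C * relabel (finRotate L ^ k) C) *ᵥ Ψ.ofLp) := by
  suffices h : Factorizes (seg L x s) ((relabel (finRotate L ^ s) C * C) *ᵥ Ψ.ofLp) by
    have := hΨ.factorizes_relabel h k
    rwa [relabel_mul, relabel_finRotate_pow_add] at this
  have hF2 := hΨ.factorizes_relabel hF s
  have aE := aC.relabel_seg s
  have aE' := aC'.relabel_seg s
  have hE' := relabel_mem_unitaryGroup (finRotate L ^ s) hC'
  rw [relabel_mul] at hF2
  set E := relabel (finRotate L ^ s) C
  set E' := relabel (finRotate L ^ s) C'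
  -- The tightest requirement: with `s ≤ 4 * w`, the supports of `E` and `C'` are disjoint because
  -- `s + w ≤ n - w`, whence the bound `6 * w ≤ n`.
  have c1 : E * C' = C' * E :=
    (aE.commute (seg_disjoint (by push_cast; omega) (by push_cast; omega)) aC').eq
  have c2 : E * C = C * E :=
    (aC.commute (seg_disjoint (by push_cast; omega) (by push_cast; omega)) aE).eq.symm
  have c3 : E' * C' = C' * E' :=
    (aC'.commute (seg_disjoint (by push_cast; omega) (by push_cast; omega)) aE').eq.symm
  have c4 : E' * C = C * E' :=
    (aC.commute (seg_disjoint (by push_cast; omega) (by push_cast; omega)) aE').eq.symm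
  have compl {S A : Finset (Fin L)} {M : Op d L} (hM : ActsOn S M) (h : Disjoint A S) :
      ActsOn Aᶜ M := hM.mono (Finset.subset_compl_iff_disjoint_left.2 h)
  -- `E` acts inside the original region and `E'` outside it.
  have f1 : Factorizes (seg L x n) ((E' * E * (C' * C)) *ᵥ Ψ.ofLp) := by
    rw [← Matrix.mulVec_mulVec, ← Matrix.mulVec_mulVec]
    refine (hF.mulVec (aE.mono (seg_subset (by omega) (by push_cast; omega)))).mulVec_of_compl
      (compl aE' (seg_disjoint (by omega) (by push_cast; omega)))
  -- For the shifted region the roles are exchanged: `C` acts outside it and `C'` inside.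
  have f2 : Factorizes (seg L (x + s) n) ((E' * E * (C' * C)) *ᵥ Ψ.ofLp) := by
    have : E' * E * (C' * C) = C' * C * (E' * E) := by
      calc E' * E * (C' * C) = E' * (E * C') * C := by noncomm_ring
        _ = (E' * C') * (E * C) := by rw [c1]; noncomm_ring
        _ = C' * (E' * C) * E := by rw [c2, c3]; noncomm_ring
        _ = C' * C * (E' * E) := by rw [c4]; noncomm_ring
    rw [this, ← Matrix.mulVec_mulVec, ← Matrix.mulVec_mulVec]
    refine (hF2.mulVec_of_compl (compl aC (seg_disjoint ?_ ?_).symm)).mulVec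
      (aC'.mono (seg_subset ?_ ?_)) <;> push_cast <;> omega
  have f3 := f1.inter f2.compl
  rw [seg_inter_compl_seg (by omega) (by omega)] at f3
  -- `C'` and `E'` act off the short segment, so undoing them keeps the factorization.
  have f4 := (f3.mulVec_of_compl (compl aE'.conjTranspose (seg_disjoint (by omega)
    (by push_cast; omega)))).mulVec_of_compl (compl aC'.conjTranspose (seg_disjoint (by omega)
    (by push_cast; omega)))
  have e : C'ᴴ * E'ᴴ * (E' * E * (C' * C)) = E * C := by
    calc C'ᴴ * E'ᴴ * (E' * E * (C' * C)) = C'ᴴ * (E'ᴴ * E') * (E * C') * C := by noncomm_ring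
      _ = (C'ᴴ * C') * E * C := by
        rw [c1, conjTranspose_mul_self_of_mem hE']; noncomm_ring
      _ = E * C := by rw [conjTranspose_mul_self_of_mem hC', one_mul]
  rwa [Matrix.mulVec_mulVec, Matrix.mulVec_mulVec, e] at f4

/-! ### Preparation from a product state -/

theorem prod_ofFn_eq_erase {M : Type*} [Monoid M] {q : ℕ} (f : Fin q → M)
    (hf : ∀ i j, i ≠ j → Commute (f i) (f j)) (j : Fin q) :
    (List.ofFn f).prod = (((List.finRange q).erase j).map f).prod * f j := by
  have hp : (List.finRange q).Perm ((List.finRange q).erase j ++ [j]) :=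
    (List.perm_cons_erase (List.mem_finRange j)).trans (List.perm_append_singleton j _).symm
  rw [List.ofFn_eq_map, (hp.map f).prod_eq', List.map_append, List.prod_append]
  · simp
  · rw [List.pairwise_map]
    exact (List.nodup_finRange q).imp fun h => hf _ _ h

theorem prod_ofFn_eq_erase_erase {M : Type*} [Monoid M] {q : ℕ} (f : Fin q → M)
    (hf : ∀ i j, i ≠ j → Commute (f i) (f j)) {i j : Fin q} (hij : i ≠ j) :
    (List.ofFn f).prod =
      ((((List.finRange q).erase j).erase i).map f).prod * (f i * f j) := by
  rw [prod_ofFn_eq_erase f hf j, ← mul_assoc]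
  congr 1
  have hmem : i ∈ (List.finRange q).erase j := by simp [(List.nodup_finRange q).mem_erase_iff, hij]
  have hp : ((List.finRange q).erase j).Perm (((List.finRange q).erase j).erase i ++ [i]) :=
    (List.perm_cons_erase hmem).trans (List.perm_append_singleton i _).symm
  rw [(hp.map f).prod_eq', List.map_append, List.prod_append]
  · simp
  · rw [List.pairwise_map]
    exact ((List.nodup_finRange q).erase j).imp fun h => hf _ _ h

/-- `Φ` has all sites of `B` in the basis state `z`. -/
def IsConstOn (z : Fin d) (B : Finset (Fin L)) (Φ : Config d L → ℂ) : Prop :=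
  ∀ σ, Φ σ ≠ 0 → ∀ i ∈ B, σ i = z

theorem IsConstOn.mulVec {z : Fin d} {B : Finset (Fin L)} {Φ : Config d L → ℂ}
    (h : IsConstOn z B Φ) {M : Op d L} (hM : ActsOn Bᶜ M) : IsConstOn z B (M *ᵥ Φ) := by
  intro σ hσ i hi
  obtain ⟨τ, -, hτ⟩ := Finset.exists_ne_zero_of_sum_ne_zero hσ
  obtain ⟨u, hu⟩ := hM
  have h1 : M σ τ ≠ 0 := left_ne_zero_of_mul hτ
  rw [hu] at h1
  have h2 : ∀ i ∉ Bᶜ, σ i = τ i := by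
    by_contra h2
    exact h1 (if_neg h2)
  rw [h2 i (by simpa using hi)]
  exact h τ (right_ne_zero_of_mul hτ) i hi

/-- The `B`-factor of the state is, up to scale, its slice `a` at a configuration `ω` of nonzero
amplitude. The normalized slice is completed to an orthonormal basis in which it has the constant
label `z`; the adjoint of the basis matrix then maps it to that basis state. -/
theorem exists_unitary_isConstOn (z : Fin d) {B : Finset (Fin L)} {Φ : Config d L → ℂ}
    (h : Factorizes B Φ) (h0 : Φ ≠ 0) :
    ∃ G : Op d L, G ∈ Matrix.unitaryGroup (Config d L) ℂ ∧ ActsOn B G ∧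
      IsConstOn z B (Gᴴ *ᵥ Φ) := by
  classical
  obtain ⟨ω, hω⟩ := Function.ne_iff.1 h0
  simp only [Pi.zero_apply] at hω
  set a : EuclideanSpace ℂ (B → Fin d) :=
    WithLp.toLp 2 fun κ => Φ ((splitEquiv d B).symm (κ, Bᶜ.restrict ω)) with ha
  have ha0 : a ≠ 0 := fun h => hω <| by
    have := congrFun (congrArg WithLp.ofLp h) (B.restrict ω)
    simpa [ha, splitEquiv_symm_restrict, Finset.piecewise_same] using this
  have hn : ‖a‖ ≠ 0 := norm_ne_zero_iff.2 ha0
  set v : EuclideanSpace ℂ (B → Fin d) := ((‖a‖⁻¹ : ℝ) : ℂ) • a with hv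
  have hv1 : ‖v‖ = 1 := by
    rw [hv, norm_smul]
    simp [hn]
  have hortho : Orthonormal ℂ
      (({fun _ => z} : Set (B → Fin d)).domRestrict fun _ => v) := by
    refine ⟨fun _ => hv1, fun i j hij => ?_⟩
    exact absurd (Subtype.ext (i.2.trans j.2.symm)) hij
  obtain ⟨b, hb⟩ := hortho.exists_orthonormalBasis_extension_of_card_eq (by simp)
  have hbz : b (fun _ => z) = v := hb _ rfl
  set u : Matrix (B → Fin d) (B → Fin d) ℂ := Matrix.of fun κ j => b j κ with hu
  have hu1 : uᴴ * u = 1 := by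
    ext i j
    have := orthonormal_iff_ite.1 b.orthonormal i j
    rw [Matrix.one_apply, ← this, PiLp.inner_apply, Matrix.mul_apply]
    refine Finset.sum_congr rfl fun κ _ => ?_
    simp [hu, mul_comm]
  refine ⟨localOp B u, ?_, actsOn_localOp B u, fun σ hσ => ?_⟩
  · rw [Matrix.mem_unitaryGroup_iff', Matrix.star_eq_conjTranspose, ← localOp_conjTranspose,
      ← localOp_mul, hu1, localOp_one]
  · have key : (localOp B u)ᴴ.mulVec Φ σ * Φ ω =
        inner ℂ (b (B.restrict σ)) a * Φ (B.piecewise ω σ) := by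
      rw [← localOp_conjTranspose, localOp_mulVec, PiLp.inner_apply, Finset.sum_mul,
        Finset.sum_mul]
      refine Finset.sum_congr rfl fun κ _ => ?_
      have := h ((splitEquiv d B).symm (κ, Bᶜ.restrict σ)) ω
      rw [← splitEquiv_symm_restrict, ← splitEquiv_symm_restrict, restrict_splitEquiv_symm,
        restrict_compl_splitEquiv_symm, splitEquiv_symm_restrict] at this
      simp only [hu, ha, Matrix.conjTranspose_apply, Matrix.of_apply, RCLike.inner_apply,
        RCLike.star_def]
      linear_combination (starRingEnd ℂ) ((b (B.restrict σ)).ofLp κ) * this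
    have h1 : inner ℂ (b (B.restrict σ)) a ≠ 0 := fun h1 => by
      rw [h1, zero_mul] at key
      exact (mul_ne_zero hσ hω) key
    have h2 : a = ((‖a‖ : ℝ) : ℂ) • b (fun _ => z) := by
      rw [hbz, hv, smul_smul, ← Complex.ofReal_mul, mul_inv_cancel₀ hn, Complex.ofReal_one,
        one_smul]
    have h3 : B.restrict σ = fun _ => z := by
      by_contra h3
      apply h1
      rw [h2, inner_smul_right, orthonormal_iff_ite.1 b.orthonormal, if_neg h3, mul_zero]
    intro i hi
    exact congrFun h3 ⟨i, hi⟩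

theorem isProductState_of_isConstOn (hL : 0 < L) {z : Fin d} {Φ : Ket d L}
    (h : IsConstOn z Finset.univ Φ.ofLp) (h1 : ‖Φ‖ = 1) : IsProductState Φ := by
  classical
  have h2 : ∀ σ : Config d L, σ ≠ (fun _ => z) → Φ σ = 0 := fun σ hσ => by
    by_contra h3
    exact hσ (funext fun i => h σ h3 i (Finset.mem_univ i))
  have h3 : ‖Φ fun _ => z‖ = 1 := by
    have := EuclideanSpace.norm_sq_eq Φ
    rw [h1, Finset.sum_eq_single (fun _ => z) (fun σ _ hσ => by simp [h2 σ hσ]) (by simp)] at this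
    have h4 := norm_nonneg (Φ fun _ => z)
    nlinarith
  -- One site absorbs the phase left over as the only nonzero amplitude.
  set o : Fin L := ⟨0, hL⟩
  refine ⟨fun i => if i = o then EuclideanSpace.single z (Φ fun _ => z) else
    EuclideanSpace.single z 1, fun i => ?_, fun σ => ?_⟩
  · dsimp only
    split_ifs <;> simp [h3]
  · by_cases hσ : σ = fun _ => z
    · subst hσ
      rw [Finset.prod_eq_single o]
      · simp
      · intro i _ hi
        simp [hi]
      · simp
    · obtain ⟨i, hi⟩ := Function.ne_iff.1 hσ
      rw [h2 σ hσ, eq_comm]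
      refine Finset.prod_eq_zero (Finset.mem_univ i) ?_
      dsimp only
      split_ifs <;> simp [hi]

/-- A state that local unitaries `W i` near the cuts turn into a product over blocks. -/
theorem isCircuitOfProductState_of_blocks (hd : 0 < d) (hL : 0 < L) {q r : ℕ} {Ψ : Ket d L}
    (hΨ : ‖Ψ‖ = 1) (N B : Fin q → Finset (Fin L)) (W : Fin q → Op d L)
    (hN : ∀ i j, i ≠ j → Disjoint (N i) (N j)) (hB : ∀ i j, i ≠ j → Disjoint (B i) (B j))
    (aN : ∀ i, IsArc (N i) ∧ (N i).card ≤ r) (aB : ∀ i, IsArc (B i) ∧ (B i).card ≤ r)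
    (hW : ∀ i, W i ∈ Matrix.unitaryGroup (Config d L) ℂ ∧ ActsOn (N i) (W i))
    (hcover : ∀ i : Fin L, ∃ j, i ∈ B j)
    (hF : ∀ j, Factorizes (B j) ((List.ofFn W).prod *ᵥ Ψ.ofLp)) :
    IsCircuitOfProductState 2 r Ψ := by
  classical
  set E := (List.ofFn W).prod with hE
  set Φ := E *ᵥ Ψ.ofLp with hΦ
  have hEu : E ∈ Matrix.unitaryGroup (Config d L) ℂ := by
    refine Submonoid.list_prod_mem _ fun x hx => ?_
    obtain ⟨i, rfl⟩ := List.mem_ofFn.1 hx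
    exact (hW i).1
  have hΦ1 : ‖WithLp.toLp 2 Φ‖ = 1 := (norm_toLp_mulVec hEu _).trans hΨ
  have hΦ0 : Φ ≠ 0 := fun h => by simp [h] at hΦ1
  choose G hGu hGa hGc using fun j => exists_unitary_isConstOn ⟨0, hd⟩ (hF j) hΦ0
  -- The adjoint reverses the order of the gates; commutation restores the order of the index.
  have reverse_prod (f : Fin q → Op d L) (hf : ∀ i j, i ≠ j → Commute (f i) (f j)) :
      (List.ofFn f).prodᴴ = (List.ofFn fun i => (f i)ᴴ).prod := by
    rw [Matrix.conjTranspose_list_prod, List.map_ofFn]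
    refine (List.reverse_perm _).prod_eq' ?_
    rw [List.pairwise_reverse, List.ofFn_eq_map, List.pairwise_map]
    refine (List.nodup_finRange q).imp fun {i j} h => ?_
    change (f j)ᴴ * (f i)ᴴ = (f i)ᴴ * (f j)ᴴ
    rw [← Matrix.conjTranspose_mul, ← Matrix.conjTranspose_mul, (hf i j h).eq]
  have cW : ∀ i j, i ≠ j → Commute (W i) (W j) := fun i j hij =>
    (hW i).2.commute (hN i j hij) (hW j).2
  have cG : ∀ i j, i ≠ j → Commute (G i) (G j) := fun i j hij =>
    (hGa i).commute (hB i j hij) (hGa j)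
  have cG' : ∀ i j, i ≠ j → Commute (G i)ᴴ (G j)ᴴ := fun i j hij =>
    (hGa i).conjTranspose.commute (hB i j hij) (hGa j).conjTranspose
  set F := (List.ofFn G).prod with hFdef
  have hFu : F ∈ Matrix.unitaryGroup (Config d L) ℂ := by
    refine Submonoid.list_prod_mem _ fun x hx => ?_
    obtain ⟨i, rfl⟩ := List.mem_ofFn.1 hx
    exact hGu i
  -- The layer `F` builds the block states from basis states, and the adjoint of `E` undoes the
  -- cuts.
  refine ⟨Eᴴ * F, WithLp.toLp 2 (Fᴴ *ᵥ Φ), ⟨![Eᴴ, F], ?_, by simp⟩, ?_, ?_⟩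
  · intro k
    fin_cases k
    · exact ⟨q, N, fun i => (W i)ᴴ, hN, aN, fun i => ⟨conjTranspose_mem_unitaryGroup (hW i).1,
        (hW i).2.conjTranspose⟩, reverse_prod W cW⟩
    · exact ⟨q, B, G, hB, aB, fun i => ⟨hGu i, hGa i⟩, rfl⟩
  · refine isProductState_of_isConstOn (z := ⟨0, hd⟩) hL ?_ ?_
    · intro σ hσ i _
      obtain ⟨j, hj⟩ := hcover i
      refine (?_ : IsConstOn ⟨0, hd⟩ (B j) (Fᴴ *ᵥ Φ)) σ hσ i hj
      rw [reverse_prod G cG, prod_ofFn_eq_erase _ cG' j, ← Matrix.mulVec_mulVec]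
      refine (hGc j).mulVec (ActsOn.list_prod fun M hM => ?_)
      obtain ⟨k, hk, rfl⟩ := List.mem_map.1 hM
      have hkj := ((List.nodup_finRange q).mem_erase_iff.1 hk).1
      exact (hGa k).conjTranspose.mono (Finset.subset_compl_iff_disjoint_right.2 (hB k j hkj))
    · rw [norm_toLp_mulVec (conjTranspose_mem_unitaryGroup hFu), hΦ1]
  · change Ψ.ofLp = (Eᴴ * F) *ᵥ (Fᴴ *ᵥ Φ)
    rw [Matrix.mulVec_mulVec, mul_assoc, mul_conjTranspose_self_of_mem hFu, mul_one, hΦ,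
      Matrix.mulVec_mulVec, conjTranspose_mul_self_of_mem hEu, Matrix.one_mulVec]

/-- A translation-symmetric state that is cut by unitaries near the ends of a long region is
prepared from a product state by a circuit of depth two. -/
theorem IsTranslationSymmetric.isCircuitOfProductState (hd : 0 < d) {Ψ : Ket d L}
    (hΨ : IsTranslationSymmetric Ψ) (hΨ1 : ‖Ψ‖ = 1)
    {x : ℤ} {n w : ℕ} (hw : 1 ≤ w) {C C' : Op d L}
    (hC : C ∈ Matrix.unitaryGroup (Config d L) ℂ) (hC' : C' ∈ Matrix.unitaryGroup (Config d L) ℂ)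
    (aC : ActsOn (seg L (x - w) (2 * w)) C) (aC' : ActsOn (seg L (x + n - w) (2 * w)) C')
    (hF : Factorizes (seg L x n) ((C' * C) *ᵥ Ψ.ofLp))
    (hn : 6 * w ≤ n) (hnL : n + 6 * w ≤ L) : IsCircuitOfProductState 2 (4 * w) Ψ := by
  have hL : 0 < L := by omega
  -- Blocks have `2 * w` sites; the last one absorbs the remainder `t` and stays shorter than `4 *
  -- w`.
  obtain ⟨q, t, hq, ht⟩ : ∃ q t, L = 2 * w * q + t ∧ t < 2 * w :=
    ⟨L / (2 * w), L % (2 * w), (Nat.div_add_mod _ _).symm, Nat.mod_lt _ (by omega)⟩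
  have hq6 : 6 ≤ q := by
    by_contra h
    have : 2 * w * q ≤ 2 * w * 5 := Nat.mul_le_mul_left _ (by omega)
    omega
  let s : Fin q → ℕ := fun j => if j.1 + 1 = q then 2 * w + t else 2 * w
  let N : Fin q → Finset (Fin L) := fun j => seg L (x + (2 * w * j.1 : ℕ) - w) (2 * w)
  let B : Fin q → Finset (Fin L) := fun j => seg L (x + (2 * w * j.1 : ℕ)) (s j)
  let W : Fin q → Op d L := fun j => relabel (finRotate L ^ (2 * w * j.1)) C
  have mono {i j : ℕ} (h : i + 1 ≤ j) : 2 * w * i + 2 * w ≤ 2 * w * j := by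
    rw [← Nat.mul_succ]; exact Nat.mul_le_mul_left _ h
  have hW : ∀ i, W i ∈ Matrix.unitaryGroup (Config d L) ℂ ∧ ActsOn (N i) (W i) := fun i =>
    ⟨relabel_mem_unitaryGroup _ hC, by
      have := aC.relabel_seg (2 * w * i.1)
      rwa [sub_add_eq_add_sub] at this⟩
  have hN : ∀ i j, i < j → Disjoint (N i) (N j) := fun i j hij => by
    have h1 := mono (Nat.succ_le_of_lt hij)
    have h2 := mono (Nat.succ_le_of_lt j.2)
    exact seg_disjoint (by omega) (by omega)
  have hB : ∀ i j, i < j → Disjoint (B i) (B j) := fun i j hij => by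
    have h1 := mono (Nat.succ_le_of_lt hij)
    have h2 := mono (Nat.succ_le_of_lt j.2)
    have h3 : s i = 2 * w := if_neg (by omega)
    have h4 : 2 * w * j.1 + s j ≤ L := by
      simp only [s]
      split_ifs with h
      · have h5 : 2 * w * (j.1 + 1) = 2 * w * q := by rw [h]
        rw [Nat.mul_succ] at h5
        omega
      · omega
    exact seg_disjoint (by rw [h3]; omega) (by omega)
  have symm {S : Fin q → Finset (Fin L)} (h : ∀ i j, i < j → Disjoint (S i) (S j)) :
      ∀ i j, i ≠ j → Disjoint (S i) (S j) := fun i j hij =>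
    (lt_or_gt_of_ne hij).elim (h i j) fun h' => (h j i h').symm
  refine isCircuitOfProductState_of_blocks hd hL hΨ1 N B W (symm hN) (symm hB)
    (fun i => ⟨isArc_seg hL _ _, (card_seg_le hL _ _).trans (by omega)⟩)
    (fun i => ⟨isArc_seg hL _ _, (card_seg_le hL _ _).trans ?_⟩) hW (fun i => ?_) fun j => ?_
  · simp only [s]; split_ifs <;> omega
  · have hL' : (0 : ℤ) < L := by omega
    have h1 := Int.emod_add_mul_ediv ((i : ℤ) - x) L
    have h2 := Int.emod_nonneg ((i : ℤ) - x) hL'.ne'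
    have h3 := Int.emod_lt_of_pos ((i : ℤ) - x) hL'
    obtain ⟨y, hy⟩ := Int.eq_ofNat_of_zero_le h2
    have hyL : y < L := by omega
    have h4 := Nat.div_add_mod y (2 * w)
    have h5 := Nat.mod_lt y (show 0 < 2 * w by omega)
    have mem : ∀ j, 2 * w * j.1 ≤ y → y < 2 * w * j.1 + s j → i ∈ B j := fun j h6 h7 =>
      mem_seg.2 ⟨-(((i : ℤ) - x) / L), by
        have : ((2 * w * j.1 : ℕ) : ℤ) ≤ y := by exact_mod_cast h6
        linarith, by
        have : (y : ℤ) < ((2 * w * j.1 : ℕ) : ℤ) + s j := by exact_mod_cast h7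
        linarith⟩
    by_cases h6 : y / (2 * w) + 1 < q
    · refine ⟨⟨y / (2 * w), by omega⟩, mem _ (by simp only; omega) ?_⟩
      simp only [s, if_neg h6.ne]
      omega
    · refine ⟨⟨q - 1, by omega⟩, mem _ ?_ ?_⟩
      · have : 2 * w * (q - 1) ≤ 2 * w * (y / (2 * w)) := Nat.mul_le_mul_left _ (by omega)
        simp only; omega
      · have := mono (show (q - 1) + 1 ≤ q by omega)
        have h7 : 2 * w * (q - 1) + 2 * w = 2 * w * q := by
          rw [← Nat.mul_succ]; congr 1; omega
        simp only [s, if_pos (show q - 1 + 1 = q by omega)]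
        omega
  · have cW : ∀ i j, i ≠ j → Commute (W i) (W j) := fun i j hij =>
      (hW i).2.commute (symm hN i j hij) (hW j).2
    -- `j'` is the cyclically next block, so `W j` and `W j'` are the cuts at the two ends of block
    -- `j`. For the last block the identification uses that `L` rotations are trivial.
    set j' : Fin q := if h : j.1 + 1 = q then ⟨0, by omega⟩ else ⟨j.1 + 1, by omega⟩ with hj'
    have hjj' : j' ≠ j := by
      intro h
      have := congrArg Fin.val h
      rw [hj'] at this
      split_ifs at this <;> simp only at this <;> omega
    have hWj' : W j' = relabel (finRotate L ^ (2 * w * j.1 + s j)) C := by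
      simp only [W, s, hj']
      split_ifs with h
      · have : 2 * w * j.1 + (2 * w + t) = L := by
          have h5 : 2 * w * (j.1 + 1) = 2 * w * q := by rw [h]
          rw [Nat.mul_succ] at h5
          omega
        simp [this, finRotate_pow_self]
      · simp [Nat.mul_succ]
    rw [prod_ofFn_eq_erase_erase W cW hjj', ← Matrix.mulVec_mulVec]
    refine Factorizes.mulVec_of_compl (hWj' ▸ hΨ.factorizes_seg hC' aC aC' hF hn hnL
      (by simp only [s]; split_ifs <;> omega) (by simp only [s]; split_ifs <;> omega) _)
      (ActsOn.list_prod fun M hM => ?_)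
    obtain ⟨i, hi, rfl⟩ := List.mem_map.1 hM
    obtain ⟨hij', hi⟩ := (((List.nodup_finRange q).erase j).mem_erase_iff).1 hi
    have hij := ((List.nodup_finRange q).mem_erase_iff.1 hi).1
    -- Every other cut lies at least `2 * w` from both ends of block `j`, so its window of
    -- half-width `w` misses the block.
    refine (hW i).2.mono (Finset.subset_compl_iff_disjoint_right.2 ?_)
    have hij1 : i.1 ≠ j.1 := fun h => hij (Fin.ext h)
    have hi2 := mono (Nat.succ_le_of_lt i.2)
    by_cases h : j.1 + 1 = q
    · rw [dif_pos h] at hj'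
      have hi0 : i.1 ≠ 0 := fun h0 => hij' (by rw [hj']; exact Fin.ext h0)
      have h1 := mono (show i.1 + 1 ≤ j.1 by omega)
      have h2 := mono (show 0 + 1 ≤ i.1 by omega)
      have h3 : s j = 2 * w + t := if_pos h
      have h4 : 2 * w * j.1 + (2 * w + t) = L := by
          have h5 : 2 * w * (j.1 + 1) = 2 * w * q := by rw [h]
          rw [Nat.mul_succ] at h5
          omega
      exact seg_disjoint (by omega) (by rw [h3]; omega)
    · rw [dif_neg h] at hj'
      have hi0 : i.1 ≠ j.1 + 1 := fun h0 => hij' (by rw [hj']; exact Fin.ext h0)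
      have h3 : s j = 2 * w := if_neg h
      rcases lt_or_gt_of_ne hij1 with h5 | h5
      · have h1 := mono (show i.1 + 1 ≤ j.1 by omega)
        have h2 := mono (show j.1 + 1 ≤ q - 1 by omega)
        have h6 := mono (show q - 1 + 1 ≤ q by omega)
        exact seg_disjoint (by omega) (by rw [h3]; omega)
      · have h1 := mono (show j.1 + 1 ≤ i.1 - 1 by omega)
        have h2 := mono (show i.1 - 1 + 1 ≤ i.1 by omega)
        refine (seg_disjoint ?_ ?_).symm
        · rw [h3]; omega
        · omega

/-! ### Rank deficiency of short segments -/

/-- After `V` and a rotation on `A`, all sites of `A` are in basis state `0`. Projecting them onto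
state `1`, which exists since `d ≥ 2`, kills the state. -/
theorem exists_annihilator_of_factorizes (hd : 2 ≤ d) {A I : Finset (Fin L)} (hA : A.Nonempty)
    (hAI : A ⊆ I) {V : Op d L} (hV : V ∈ Matrix.unitaryGroup (Config d L) ℂ) (aV : ActsOn I V)
    {Ψ : Config d L → ℂ} (hΨ : Ψ ≠ 0) (hF : Factorizes A (V *ᵥ Ψ)) :
    ∃ M : Op d L, M ≠ 0 ∧ ActsOn I M ∧ M *ᵥ Ψ = 0 := by
  classical
  have h0 : V *ᵥ Ψ ≠ 0 := fun h => hΨ <| by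
    have := congrArg (Vᴴ *ᵥ ·) h
    simpa [Matrix.mulVec_mulVec, conjTranspose_mul_self_of_mem hV] using this
  obtain ⟨G, hG, aG, hc⟩ := exists_unitary_isConstOn ⟨0, by omega⟩ hF h0
  set c : A → Fin d := fun _ => ⟨1, hd⟩ with hcdef
  set Q : Op d L := localOp A (Matrix.single c c 1) with hQ
  refine ⟨Q * Gᴴ * V, fun h => ?_, (((actsOn_localOp A _).mul aG.conjTranspose).mono hAI).mul aV,
    ?_⟩
  · have h1 : Q * Gᴴ * V * Vᴴ * G = Q := by
      rw [mul_assoc (Q * Gᴴ), mul_conjTranspose_self_of_mem hV, mul_one, mul_assoc,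
        conjTranspose_mul_self_of_mem hG, mul_one]
    rw [h, zero_mul, zero_mul] at h1
    have h2 := congrFun (congrFun h1 fun _ => ⟨1, hd⟩) fun _ => ⟨1, hd⟩
    rw [hQ, localOp_apply, if_pos fun _ _ => rfl] at h2
    change (0 : ℂ) = Matrix.single c c 1 c c at h2
    simp at h2
  · ext σ
    rw [← Matrix.mulVec_mulVec, ← Matrix.mulVec_mulVec, hQ, localOp_mulVec, Pi.zero_apply]
    refine Finset.sum_eq_zero fun a _ => ?_
    by_cases ha : c = a
    · subst ha
      obtain ⟨i, hi⟩ := hA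
      refine mul_eq_zero_of_right _ ?_
      by_contra h1
      have h2 := hc _ h1 i hi
      have h3 := congrFun (restrict_splitEquiv_symm A c (Aᶜ.restrict σ)) ⟨i, hi⟩
      rw [Finset.restrict, h2] at h3
      simp [hcdef] at h3
    · simp [Matrix.single, ha]

theorem relabel_ne_zero (e : Equiv.Perm (Fin L)) {M : Op d L} (h : M ≠ 0) : relabel e M ≠ 0 := by
  intro h1
  apply h
  ext σ τ
  have := congrFun (congrFun h1 (σ ∘ e.symm)) (τ ∘ e.symm)
  simpa [relabel, Function.comp_assoc] using this

theorem seg_nonempty (hL : 0 < L) (a : ℤ) {n : ℕ} (hn : 0 < n) : (seg L a n).Nonempty := by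
  obtain ⟨i, k, hk⟩ := exists_site hL a
  exact ⟨i, mem_seg.2 ⟨k, by omega, by omega⟩⟩

theorem IsTranslationSymmetric.exists_annihilator (hd : 2 ≤ d) {D r : ℕ} {A : Finset (Fin L)}
    {Ψ : Ket d L} (hΨ : IsTranslationSymmetric Ψ) (hA : IsArc A) (hA0 : A.Nonempty)
    (hA1 : Aᶜ.Nonempty) (h : IsCircuitOfBipartiteProduct D r A Ψ) :
    ∃ M : Op d L, M ≠ 0 ∧ ActsOn (seg L 0 (8 * (1 + D * r))) M ∧ M *ᵥ Ψ.ofLp = 0 := by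
  have hΨ0 : Ψ.ofLp ≠ 0 := fun h0 => by
    have h1 : ‖Ψ‖ = 1 := h.norm_eq_one
    have h2 : Ψ = 0 := congrArg (WithLp.toLp 2) h0
    simp [h2] at h1
  obtain ⟨hL, x, n, hn, rfl, hcard⟩ := hA.exists_seg
  have hn0 : 0 < n := hcard ▸ hA0.card_pos
  have hnL : n < L := by
    have := hA1.card_pos
    rw [Finset.card_compl, hcard, Fintype.card_fin] at this
    omega
  obtain ⟨C, C', hC, hC', aC, aC', hF⟩ := h.exists_disentangler hn
  set w := 1 + D * r with hw
  have hw1 : 1 ≤ w := by omega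
  -- By translation symmetry the segment may start anywhere.
  suffices h : ∃ (a : ℤ) (M : Op d L), M ≠ 0 ∧ ActsOn (seg L a (8 * w)) M ∧ M *ᵥ Ψ.ofLp = 0 by
    obtain ⟨a, M, hM, aM, h⟩ := h
    have hL' : (0 : ℤ) < L := by omega
    obtain ⟨k, hk⟩ := Int.eq_ofNat_of_zero_le (Int.emod_nonneg (-a) hL'.ne')
    refine ⟨relabel (finRotate L ^ k) M, relabel_ne_zero _ hM, ?_, ?_⟩
    · have h1 := aM.relabel_seg k
      have h2 := Int.emod_add_mul_ediv (-a) L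
      rwa [show a + k = 0 + (-(-a / L)) * L by linarith, seg_add_int_mul] at h1
    · obtain ⟨c, hc⟩ := hΨ.exists_relabel_mulVec k M
      rw [hc, h]
      ext σ
      simp
  -- A region shorter than `6 * w` fits with both windows into `8 * w` sites; the same goes for a
  -- short complement. If both are long, a segment of `2 * w` sites is cut out instead.
  rcases lt_or_ge n (6 * w) with h1 | h1
  · exact ⟨x - w, exists_annihilator_of_factorizes hd hA0
      (seg_subset (by omega) (by push_cast; omega)) (mul_mem hC' hC)
      ((aC'.mono (seg_subset (by omega) (by push_cast; omega))).mul
        (aC.mono (seg_subset (by omega) (by push_cast; omega)))) hΨ0 hF⟩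
  rcases lt_or_ge L (n + 6 * w) with h2 | h2
  · have hF' := hF.compl
    rw [seg_compl hn] at hF' hA1
    rw [← seg_add_period] at aC
    exact ⟨x + n - w, exists_annihilator_of_factorizes hd hA1
      (seg_subset (by omega) (by push_cast; omega)) (mul_mem hC' hC)
      ((aC'.mono (seg_subset (by omega) (by push_cast; omega))).mul
        (aC.mono (seg_subset (by omega) (by push_cast; omega)))) hΨ0 hF'⟩
  · have hF' := hΨ.factorizes_seg hC' aC aC' hF h1 h2 (s := 2 * w) le_rfl (by omega) 0
    exact ⟨x - w, exists_annihilator_of_factorizes hd (seg_nonempty hL _ (by omega))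
      (seg_subset (by push_cast; omega) (by push_cast; omega))
      (mul_mem (relabel_mem_unitaryGroup _ hC) (relabel_mem_unitaryGroup _ hC))
      (((aC.relabel_seg _).mono (seg_subset (by push_cast; omega) (by push_cast; omega))).mul
        ((aC.relabel_seg _).mono (seg_subset (by push_cast; omega) (by push_cast; omega)))) hΨ0 hF'⟩

/-- An operator on `S` that annihilates `Ψ` yields a unit vector that is orthogonal to the reduced
density matrix of `Ψ` on `S`. -/
theorem exists_unit_vector_of_annihilator {S : Finset (Fin L)} {M : Op d L} (h0 : M ≠ 0)
    (aM : ActsOn S M) {Ψ : Config d L → ℂ} (h : M *ᵥ Ψ = 0) :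
    ∃ v : EuclideanSpace ℂ (S → Fin d), ‖v‖ = 1 ∧
      ∀ y : (S → Fin d) → ℂ, localOp S (Matrix.vecMulVec y (star v.ofLp)) *ᵥ Ψ = 0 := by
  obtain ⟨u, rfl⟩ := (actsOn_iff S M).1 aM
  have hu : u ≠ 0 := by
    rintro rfl
    exact h0 (by ext σ τ; simp [localOp_apply])
  -- A nonzero row of `u`, conjugated and normalized, is the required vector.
  obtain ⟨κ, hκ⟩ := Function.ne_iff.1 hu
  set v : EuclideanSpace ℂ (S → Fin d) := WithLp.toLp 2 (star (u κ)) with hv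
  have hv0 : v ≠ 0 := fun h1 => hκ <| by
    have := congrArg WithLp.ofLp h1
    exact star_eq_zero.1 this
  have hn : ‖v‖ ≠ 0 := norm_ne_zero_iff.2 hv0
  refine ⟨((‖v‖⁻¹ : ℝ) : ℂ) • v, by rw [norm_smul]; simp [hn], fun y => ?_⟩
  ext σ
  have h1 := congrFun h ((splitEquiv d S).symm (κ, Sᶜ.restrict σ))
  rw [localOp_mulVec, restrict_splitEquiv_symm, restrict_compl_splitEquiv_symm,
    Pi.zero_apply] at h1
  rw [localOp_mulVec, Pi.zero_apply,
    ← mul_zero (y (S.restrict σ) * ((‖v‖⁻¹ : ℝ) : ℂ)), ← h1, Finset.mul_sum]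
  refine Finset.sum_congr rfl fun a _ => ?_
  simp [Matrix.vecMulVec_apply, hv]
  ring

/-! ### Nets of unit vectors -/

/-- Round real and imaginary parts down to multiples of `1 / M`, then normalize. Since `v` is itself
a unit vector, normalizing moves the rounded point no further than rounding moved `v`, so the error
at most doubles. -/
theorem exists_net (ι : Type*) [Fintype ι] [Nonempty ι] [DecidableEq ι] {M : ℕ} (hM : 0 < M) :
    ∃ 𝒩 : Finset (EuclideanSpace ℂ ι), 𝒩.card ≤ (2 * M + 1) ^ (2 * Fintype.card ι) ∧
      (∀ u ∈ 𝒩, ‖u‖ = 1) ∧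
      ∀ v : EuclideanSpace ℂ ι, ‖v‖ = 1 → ∃ u ∈ 𝒩, ‖v - u‖ ≤ 4 * Fintype.card ι / M := by
  classical
  have hM' : (0 : ℝ) < M := by exact_mod_cast hM
  let e : EuclideanSpace ℂ ι := EuclideanSpace.single (Classical.arbitrary ι) 1
  have he : ‖e‖ = 1 := by simp [e]
  let F : (ι → ℤ × ℤ) → EuclideanSpace ℂ ι := fun f =>
    WithLp.toLp 2 fun i => ((f i).1 / M : ℝ) + ((f i).2 / M : ℝ) * Complex.I
  let N : EuclideanSpace ℂ ι → EuclideanSpace ℂ ι := fun x =>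
    -- A fixed unit vector stands in where the rounded point vanishes.
    if x = 0 then e else ((‖x‖⁻¹ : ℝ) : ℂ) • x
  have hN : ∀ x, ‖N x‖ = 1 := fun x => by
    by_cases h : x = 0
    · simp [N, h, he]
    · simp only [N, if_neg h, norm_smul]
      simp [norm_ne_zero_iff.2 h]
  refine ⟨(Fintype.piFinset fun _ : ι => Finset.Icc (-M : ℤ) M ×ˢ Finset.Icc (-M : ℤ) M).image
    fun f => N (F f), ?_, ?_, ?_⟩
  · refine Finset.card_image_le.trans ?_
    rw [Fintype.card_piFinset]
    simp only [Finset.card_product, Int.card_Icc, Finset.prod_const, Finset.card_univ]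
    rw [show ((M : ℤ) + 1 - -M).toNat = 2 * M + 1 by omega, ← sq, ← pow_mul]
  · intro u hu
    obtain ⟨f, -, rfl⟩ := Finset.mem_image.1 hu
    exact hN _
  · intro v hv
    let f : ι → ℤ × ℤ := fun i => (⌊M * (v i).re⌋, ⌊M * (v i).im⌋)
    have hvi : ∀ i, ‖v i‖ ≤ 1 := fun i => hv ▸ PiLp.norm_apply_le v i
    have hIcc : ∀ t : ℝ, |t| ≤ 1 → ⌊M * t⌋ ∈ Finset.Icc (-M : ℤ) M := fun t ht => by
      obtain ⟨h1, h2⟩ := abs_le.1 ht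
      rw [Finset.mem_Icc]
      constructor
      · rw [Int.le_floor]; push_cast; nlinarith
      · have : (⌊M * t⌋ : ℝ) ≤ M := (Int.floor_le _).trans (by nlinarith)
        exact_mod_cast this
    have hround : ∀ t : ℝ, |t - ⌊M * t⌋ / M| ≤ 1 / M := fun t => by
      have h1 := Int.floor_le (M * t)
      have h2 := Int.lt_floor_add_one (M * t)
      have h3 : t - ⌊M * t⌋ / M = (M * t - ⌊M * t⌋) / M := by field_simp
      rw [h3, abs_div, abs_of_pos hM', abs_of_nonneg (by linarith)]
      gcongr
      linarith
    refine ⟨N (F f), Finset.mem_image_of_mem _ ?_, ?_⟩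
    · rw [Fintype.mem_piFinset]
      intro i
      rw [Finset.mem_product]
      exact ⟨hIcc _ ((Complex.abs_re_le_norm _).trans (hvi i)),
        hIcc _ ((Complex.abs_im_le_norm _).trans (hvi i))⟩
    · have hc : (1 : ℝ) ≤ Fintype.card ι := by exact_mod_cast Fintype.card_pos
      have h1 : ‖v - F f‖ ≤ 2 * Fintype.card ι / M := by
        have h2 : ∀ i, ‖(v - F f) i‖ ≤ 2 / M := fun i => by
          refine (Complex.norm_le_abs_re_add_abs_im _).trans ?_
          have h3 : ((v - F f) i).re = (v i).re - ⌊M * (v i).re⌋ / M := by simp [F, f]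
          have h4 : ((v - F f) i).im = (v i).im - ⌊M * (v i).im⌋ / M := by simp [F, f]
          rw [h3, h4]
          have h5 := hround (v i).re
          have h6 := hround (v i).im
          have : (2 : ℝ) / M = 1 / M + 1 / M := by ring
          linarith
        refine abs_le_of_sq_le_sq' ?_ (by positivity) |>.2
        rw [EuclideanSpace.norm_sq_eq]
        calc ∑ i, ‖(v - F f) i‖ ^ 2 ≤ ∑ _i : ι, (2 / M : ℝ) ^ 2 := by
              gcongr with i; exact h2 i
          _ = Fintype.card ι * (2 / M : ℝ) ^ 2 := by simp
          _ ≤ (Fintype.card ι) ^ 2 * (2 / M : ℝ) ^ 2 := by gcongr; nlinarith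
          _ = (2 * Fintype.card ι / M) ^ 2 := by ring
      have h2 : ‖F f - N (F f)‖ ≤ ‖v - F f‖ := by
        by_cases h : F f = 0
        · simp [N, h, he, hv]
        · have h3 : F f - N (F f) = ((1 - ‖F f‖⁻¹ : ℝ) : ℂ) • F f := by
            simp only [N, if_neg h]
            push_cast
            rw [sub_smul, one_smul]
          have h4 : ‖F f‖ ≠ 0 := norm_ne_zero_iff.2 h
          rw [h3, norm_smul, Complex.norm_real, Real.norm_eq_abs, ← abs_norm (F f), ← abs_mul,
            abs_norm, sub_mul, one_mul, inv_mul_cancel₀ h4, ← hv, abs_sub_comm]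
          exact abs_norm_sub_norm_le _ _
      calc ‖v - N (F f)‖ ≤ ‖v - F f‖ + ‖F f - N (F f)‖ := norm_sub_le_norm_sub_add_norm_sub _ _ _
        _ ≤ 2 * Fintype.card ι / M + 2 * Fintype.card ι / M := by linarith
        _ = 4 * Fintype.card ι / M := by ring

/-! ### Projectors that nearly fix a rank-deficient state -/

theorem norm_toLp_comp (e : Equiv.Perm (Fin L)) (Φ : Config d L → ℂ) :
    ‖WithLp.toLp 2 fun σ : Config d L => Φ (σ ∘ e)‖ = ‖WithLp.toLp 2 Φ‖ := by
  rw [EuclideanSpace.norm_eq, EuclideanSpace.norm_eq]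
  congr 1
  exact Fintype.sum_equiv (compEquiv d e) _ _ fun σ => by simp [compEquiv_apply]

/-- Cauchy–Schwarz on each slice with the configuration outside `S` fixed. -/
theorem norm_localOp_vecMulVec_mulVec_le (S : Finset (Fin L))
    (x y : EuclideanSpace ℂ (S → Fin d)) (Φ : Config d L → ℂ) :
    ‖WithLp.toLp 2 (localOp S (Matrix.vecMulVec x.ofLp (star y.ofLp)) *ᵥ Φ)‖ ≤
      ‖x‖ * ‖y‖ * ‖WithLp.toLp 2 Φ‖ := by
  refine abs_le_of_sq_le_sq' ?_ (by positivity) |>.2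
  rw [mul_pow, mul_pow, EuclideanSpace.norm_sq_eq, sum_splitEquiv S,
    EuclideanSpace.norm_sq_eq (WithLp.toLp 2 Φ), sum_splitEquiv S, Finset.mul_sum]
  refine Finset.sum_le_sum fun b _ => ?_
  set ψ : EuclideanSpace ℂ (S → Fin d) :=
    WithLp.toLp 2 fun κ => Φ ((splitEquiv d S).symm (κ, b)) with hψ
  have h1 : ∀ a, (localOp S (Matrix.vecMulVec x.ofLp (star y.ofLp)) *ᵥ Φ)
      ((splitEquiv d S).symm (a, b)) = x a * inner ℂ y ψ := fun a => by
    rw [localOp_mulVec, restrict_splitEquiv_symm, restrict_compl_splitEquiv_symm,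
      PiLp.inner_apply, Finset.mul_sum]
    refine Finset.sum_congr rfl fun κ _ => ?_
    simp [Matrix.vecMulVec_apply, hψ]
    ring
  have h2 := norm_inner_le_norm (𝕜 := ℂ) y ψ
  simp only [h1, norm_mul, mul_pow, ← Finset.sum_mul]
  have h3 := EuclideanSpace.norm_sq_eq ψ
  simp only [hψ] at h3
  rw [← EuclideanSpace.norm_sq_eq, ← h3, mul_assoc, ← mul_pow ‖y‖]
  gcongr

theorem norm_one_sub_mulVec_le {ι : Type*} [Fintype ι] [DecidableEq ι] {P : Matrix ι ι ℂ}
    (h1 : Pᴴ = P) (h2 : P * P = P) (x : ι → ℂ) :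
    ‖WithLp.toLp 2 ((1 - P) *ᵥ x)‖ ≤ ‖WithLp.toLp 2 x‖ := by
  have key : ‖WithLp.toLp 2 x‖ ^ 2 =
      ‖WithLp.toLp 2 ((1 - P) *ᵥ x)‖ ^ 2 + ‖WithLp.toLp 2 (P *ᵥ x)‖ ^ 2 := by
    rw [← Complex.ofReal_inj, Complex.ofReal_add, norm_toLp_sq, norm_toLp_sq, norm_toLp_sq,
      Matrix.star_mulVec, Matrix.star_mulVec, ← Matrix.dotProduct_mulVec,
      ← Matrix.dotProduct_mulVec, Matrix.mulVec_mulVec, Matrix.mulVec_mulVec,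
      ← dotProduct_add, ← Matrix.add_mulVec]
    have : (1 - P)ᴴ * (1 - P) + Pᴴ * P = 1 := by
      rw [Matrix.conjTranspose_sub, Matrix.conjTranspose_one, h1]
      rw [sub_mul, mul_sub, mul_sub, h2]
      simp
    rw [this, Matrix.one_mulVec]
  refine abs_le_of_sq_le_sq' ?_ (norm_nonneg _) |>.2
  nlinarith [sq_nonneg ‖WithLp.toLp 2 (P *ᵥ x)‖]

/-- The projector onto the complement of `u` in the segment `0, …, m - 1`. -/
def segProj (L m : ℕ) (u : EuclideanSpace ℂ (seg L 0 m → Fin d)) : Op d L :=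
  1 - localOp (seg L 0 m) (Matrix.vecMulVec u.ofLp (star u.ofLp))

/-- The product of the translates of `segProj` to the first `K` disjoint segments. -/
def blockProj (m : ℕ) (u : EuclideanSpace ℂ (seg L 0 m → Fin d)) : ℕ → Op d L
  | 0 => 1
  | K + 1 => relabel (finRotate L ^ (m * K)) (segProj L m u) * blockProj m u K

section

variable {m : ℕ} {u : EuclideanSpace ℂ (seg L 0 m → Fin d)}

theorem vecMulVec_mul_self (hu : ‖u‖ = 1) :
    Matrix.vecMulVec u.ofLp (star u.ofLp) * Matrix.vecMulVec u.ofLp (star u.ofLp) =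
      Matrix.vecMulVec u.ofLp (star u.ofLp) := by
  have := norm_toLp_sq u.ofLp
  rw [WithLp.toLp_ofLp, hu] at this
  rw [Matrix.vecMulVec_mul_vecMulVec, ← this]
  simp

theorem segProj_eq (u : EuclideanSpace ℂ (seg L 0 m → Fin d)) :
    segProj L m u = localOp (seg L 0 m) (1 - Matrix.vecMulVec u.ofLp (star u.ofLp)) := by
  rw [segProj, localOp_sub, localOp_one]

theorem segProj_conjTranspose : (segProj L m u)ᴴ = segProj L m u := by
  rw [segProj_eq, ← localOp_conjTranspose, Matrix.conjTranspose_sub, Matrix.conjTranspose_one,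
    Matrix.conjTranspose_vecMulVec, star_star]

theorem segProj_mul_self (hu : ‖u‖ = 1) : segProj L m u * segProj L m u = segProj L m u := by
  rw [segProj_eq, ← localOp_mul]
  congr 1
  rw [sub_mul, mul_sub, mul_sub, vecMulVec_mul_self hu]
  simp

theorem actsOn_segProj : ActsOn (seg L 0 m) (segProj L m u) := by
  rw [segProj_eq]
  exact actsOn_localOp _ _

theorem trace_segProj (hL : 0 < L) (hm : m ≤ L) (hd : 0 < d) (hu : ‖u‖ = 1) :
    (segProj L m u).trace = (d : ℂ) ^ L * (1 - ((d : ℂ) ^ m)⁻¹) := by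
  have h1 := trace_localOp (seg L 0 m) (Matrix.vecMulVec u.ofLp (star u.ofLp))
  rw [card_seg hL _ hm, Matrix.trace_vecMulVec, dotProduct_comm, ← norm_toLp_sq,
    WithLp.toLp_ofLp, hu] at h1
  have hd' : (d : ℂ) ^ m ≠ 0 := pow_ne_zero _ (by exact_mod_cast hd.ne')
  have h2 : (localOp (seg L 0 m) (Matrix.vecMulVec u.ofLp (star u.ofLp))).trace =
      (d : ℂ) ^ L * ((d : ℂ) ^ m)⁻¹ := by
    field_simp
    simpa [mul_comm] using h1
  rw [segProj, Matrix.trace_sub, h2, Matrix.trace_one]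
  simp
  ring

theorem actsOn_blockProj (K : ℕ) : ActsOn (seg L 0 (m * K)) (blockProj m u K) := by
  induction K with
  | zero => exact ActsOn.one _
  | succ K ih =>
    refine ((actsOn_segProj.relabel_seg (m * K)).mono (seg_subset ?_ ?_)).mul
      (ih.mono (seg_subset ?_ ?_)) <;> push_cast <;> nlinarith

/-- The blocks are disjoint, so traces multiply and each contributes `1 - d^(-m)`. With the adjoint
in the trace, `blockProj` itself need not be shown to be a projector. -/
theorem trace_blockProj (hd : 0 < d) (hm : 0 < m) (hu : ‖u‖ = 1) {K : ℕ} (hK : m * K ≤ L) :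
    (blockProj m u K * (blockProj m u K)ᴴ).trace = (d : ℂ) ^ L * (1 - ((d : ℂ) ^ m)⁻¹) ^ K := by
  induction K with
  | zero => simp [blockProj, Matrix.trace_one]
  | succ K ih =>
    have hK' : m * K + m ≤ L := by rwa [Nat.mul_succ] at hK
    have hd' : (d : ℂ) ^ L ≠ 0 := pow_ne_zero _ (by exact_mod_cast hd.ne')
    set g := relabel (finRotate L ^ (m * K)) (segProj L m u) with hg
    have h1 : gᴴ * g = g := by
      rw [hg, ← relabel_conjTranspose, ← relabel_mul, segProj_conjTranspose, segProj_mul_self hu]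
    have h2 := ActsOn.trace_mul (M := g) (N := blockProj m u K * (blockProj m u K)ᴴ)
      (seg_disjoint (L := L) (a := 0) (b := 0 + (m * K : ℕ)) (n := m * K) (m := m) (by omega)
        (by omega)).symm
      (actsOn_segProj.relabel_seg (m * K))
      ((actsOn_blockProj K).mul (actsOn_blockProj K).conjTranspose)
    rw [hg, trace_relabel, trace_segProj (by omega) (by omega) hd hu, ih (by omega), ← hg] at h2
    have h3 : (g * blockProj m u K * (g * blockProj m u K)ᴴ).trace =
        (g * (blockProj m u K * (blockProj m u K)ᴴ)).trace := by
      rw [Matrix.conjTranspose_mul, Matrix.trace_mul_comm, ← mul_assoc, mul_assoc _ gᴴ, h1,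
        mul_assoc, Matrix.trace_mul_comm, mul_assoc]
    change (g * blockProj m u K * (g * blockProj m u K)ᴴ).trace = _
    rw [h3]
    apply mul_left_cancel₀ hd'
    rw [h2]
    ring

/-- Each new factor is a contraction, so it does not enlarge the old error, and by translation
invariance it adds at most `δ`. -/
theorem norm_sub_blockProj_mulVec_le {Ψ : Config d L → ℂ} (hu : ‖u‖ = 1)
    (hT : ∀ k, (fun σ => Ψ (σ ∘ ⇑(finRotate L ^ k))) = Ψ) {δ : ℝ}
    (hδ : ‖WithLp.toLp 2
      (localOp (seg L 0 m) (Matrix.vecMulVec u.ofLp (star u.ofLp)) *ᵥ Ψ)‖ ≤ δ) (K : ℕ) :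
    ‖WithLp.toLp 2 (Ψ - blockProj m u K *ᵥ Ψ)‖ ≤ K * δ := by
  induction K with
  | zero => simp [blockProj]
  | succ K ih =>
    set h := localOp (seg L 0 m) (Matrix.vecMulVec u.ofLp (star u.ofLp)) with hh
    set e := finRotate L ^ (m * K)
    have e1 : relabel e (segProj L m u) = 1 - relabel e h := by
      conv_rhs => rw [← relabel_one e]
      rfl
    have e2 : Ψ - blockProj m u (K + 1) *ᵥ Ψ =
        relabel e h *ᵥ Ψ + (1 - relabel e h) *ᵥ (Ψ - blockProj m u K *ᵥ Ψ) := by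
      rw [blockProj, ← Matrix.mulVec_mulVec, e1]
      simp only [Matrix.mulVec_sub, Matrix.sub_mulVec, Matrix.one_mulVec]
      abel
    have e3 : ‖WithLp.toLp 2 (relabel e h *ᵥ Ψ)‖ ≤ δ := by
      have := relabel_mulVec e h Ψ
      rw [hT] at this
      rwa [this, norm_toLp_comp]
    have e4 : (relabel e h)ᴴ = relabel e h := by
      rw [← relabel_conjTranspose, hh, ← localOp_conjTranspose, Matrix.conjTranspose_vecMulVec,
        star_star]
    have e5 : relabel e h * relabel e h = relabel e h := by
      rw [← relabel_mul, hh, ← localOp_mul, vecMulVec_mul_self hu]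
    rw [e2, WithLp.toLp_add]
    refine (norm_add_le _ _).trans ?_
    have := norm_one_sub_mulVec_le e4 e5 (Ψ - blockProj m u K *ᵥ Ψ)
    push_cast
    linarith

/-- The bra of `v` annihilates the state, so the bra of `u` may be replaced by that of `u - v`. -/
theorem norm_localOp_le_of_orthogonal {Ψ : Config d L → ℂ} (hΨ : ‖WithLp.toLp 2 Ψ‖ = 1)
    {v : EuclideanSpace ℂ (seg L 0 m → Fin d)} (hu : ‖u‖ = 1)
    (hv : ∀ y, localOp (seg L 0 m) (Matrix.vecMulVec y (star v.ofLp)) *ᵥ Ψ = 0) :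
    ‖WithLp.toLp 2
      (localOp (seg L 0 m) (Matrix.vecMulVec u.ofLp (star u.ofLp)) *ᵥ Ψ)‖ ≤ ‖v - u‖ := by
  have h1 : localOp (seg L 0 m) (Matrix.vecMulVec u.ofLp (star u.ofLp)) *ᵥ Ψ =
      localOp (seg L 0 m) (Matrix.vecMulVec u.ofLp (star (u - v).ofLp)) *ᵥ Ψ := by
    rw [WithLp.ofLp_sub, star_sub, Matrix.vecMulVec_sub, localOp_sub, Matrix.sub_mulVec, hv,
      sub_zero]
  have := norm_localOp_vecMulVec_mulVec_le (seg L 0 m) u (u - v) Ψ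
  rwa [← h1, hu, hΨ, one_mul, mul_one, norm_sub_rev] at this

end

/-! ### The maximally mixed translation-invariant state -/

theorem translation_pow_apply (n : ℕ) (σ τ : Config d L) :
    (translation d L ^ n) σ τ = if σ ∘ ⇑(finRotate L ^ n) = τ then 1 else 0 := by
  have := congrFun (translation_pow_mulVec n (Pi.single τ 1)) σ
  rw [Matrix.mulVec_single_one] at this
  exact this.trans (Pi.single_apply τ 1 _)

theorem translation_pow_self (d L : ℕ) : translation d L ^ L = 1 := by
  ext σ τ
  rw [translation_pow_apply, finRotate_pow_self, Matrix.one_apply]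
  rfl

theorem translation_mul_conjTranspose (d L : ℕ) :
    translation d L * (translation d L)ᴴ = 1 := by
  ext σ τ
  have h : τ ∘ finRotate L = σ ∘ finRotate L ↔ σ = τ := by
    rw [← compEquiv_apply, ← compEquiv_apply, (compEquiv d (finRotate L)).injective.eq_iff, eq_comm]
  simp only [Matrix.mul_apply, Matrix.conjTranspose_apply, translation, Matrix.of_apply,
    Matrix.one_apply, ite_mul, one_mul, zero_mul, Finset.sum_ite_eq', Finset.mem_univ, if_true]
  by_cases h' : σ = τ
  · simp [h']
  · rw [if_neg h', if_neg fun h1 => h' (h.1 h1.symm), star_zero]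

theorem translation_mul_translationProjector (d L : ℕ) :
    translation d L * translationProjector d L = translationProjector d L := by
  rw [translationProjector, Matrix.mul_smul, Finset.mul_sum]
  congr 1
  have h1 := Finset.sum_range_succ' (fun n => translation d L ^ n) L
  have h2 := Finset.sum_range_succ (fun n => translation d L ^ n) L
  rw [h2, pow_zero, translation_pow_self] at h1
  rw [add_right_cancel h1]
  exact Finset.sum_congr rfl fun n _ => (pow_succ' _ _).symm

theorem translationProjector_conjTranspose_mul_self (hL : 0 < L) :
    (translationProjector d L)ᴴ * translationProjector d L = translationProjector d L := by
  have h1 : (translation d L)ᴴ * translationProjector d L = translationProjector d L := by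
    conv_lhs => rw [← translation_mul_translationProjector, ← mul_assoc,
      mul_eq_one_comm.1 (translation_mul_conjTranspose d L), one_mul]
  have h2 : ∀ n, (translation d L ^ n)ᴴ * translationProjector d L = translationProjector d L := by
    intro n
    induction n with
    | zero => simp
    | succ n ih => rw [pow_succ, Matrix.conjTranspose_mul, mul_assoc, ih, h1]
  conv_lhs => rw [translationProjector, Matrix.conjTranspose_smul, Matrix.conjTranspose_sum,
    Matrix.smul_mul, Finset.sum_mul]
  rw [← translationProjector, Finset.sum_congr rfl fun n _ => h2 n]
  have : (L : ℂ) ≠ 0 := by exact_mod_cast hL.ne'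
  rw [Finset.sum_const, Finset.card_range, ← Nat.cast_smul_eq_nsmul ℂ, smul_smul]
  simp [this]

theorem translationProjector_conjTranspose (hL : 0 < L) :
    (translationProjector d L)ᴴ = translationProjector d L := by
  conv_lhs => rw [← translationProjector_conjTranspose_mul_self hL]
  rw [Matrix.conjTranspose_mul, Matrix.conjTranspose_conjTranspose,
    translationProjector_conjTranspose_mul_self hL]

/-- Each power of the translation has as trace its number of fixed configurations, which is
nonnegative; the zeroth power alone gives `d ^ L`. -/
theorem exists_trace_translationProjector (hL : 0 < L) :
    ∃ t : ℝ, (d : ℝ) ^ L / L ≤ t ∧ (translationProjector d L).trace = (t : ℂ) := by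
  classical
  have h1 : ∀ n, (translation d L ^ n).trace =
      (((Finset.univ.filter fun σ : Config d L => σ ∘ ⇑(finRotate L ^ n) = σ).card : ℝ) : ℂ) := by
    intro n
    simp [Matrix.trace, translation_pow_apply]
  refine ⟨(L : ℝ)⁻¹ * ∑ n ∈ Finset.range L,
    ((Finset.univ.filter fun σ : Config d L => σ ∘ ⇑(finRotate L ^ n) = σ).card : ℝ), ?_, ?_⟩
  · rw [div_eq_inv_mul]
    gcongr
    refine le_trans ?_ (Finset.single_le_sum (fun n _ => Nat.cast_nonneg _)
      (Finset.mem_range.2 hL))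
    simp
  · rw [translationProjector, Matrix.trace_smul, Matrix.trace_sum]
    simp only [h1]
    push_cast
    rfl

theorem trace_mul_ketBra_mul (M : Op d L) (Ψ : Ket d L) :
    (M * ketBra Ψ * Mᴴ).trace = ((‖WithLp.toLp 2 (M *ᵥ Ψ.ofLp)‖ ^ 2 : ℝ) : ℂ) := by
  rw [norm_toLp_sq, ketBra, Matrix.mul_vecMulVec, Matrix.vecMulVec_mul, Matrix.trace_vecMulVec,
    Matrix.star_mulVec, dotProduct_comm]

theorem re_trace_mul_conjTranspose_nonneg (M : Op d L) : 0 ≤ (M * Mᴴ).trace.re := by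
  simp only [Matrix.trace, Matrix.diag, Matrix.mul_apply, Matrix.conjTranspose_apply,
    Complex.re_sum]
  refine Finset.sum_nonneg fun σ _ => Finset.sum_nonneg fun τ _ => ?_
  rw [Complex.star_def, Complex.mul_conj]
  simpa using Complex.normSq_nonneg _

theorem re_trace_mul_translationProjector_mul_le (hL : 0 < L) (G : Op d L) :
    (G * translationProjector d L * Gᴴ).trace.re ≤ (G * Gᴴ).trace.re := by
  have hP := translationProjector_conjTranspose (d := d) hL
  have hP2 := translationProjector_conjTranspose_mul_self (d := d) hL
  set P := translationProjector d L
  rw [hP] at hP2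
  have h := re_trace_mul_conjTranspose_nonneg (G * (1 - P))
  have e : G * (1 - P) * (G * (1 - P))ᴴ = G * Gᴴ - G * P * Gᴴ := by
    rw [Matrix.conjTranspose_mul, Matrix.conjTranspose_sub, hP, Matrix.conjTranspose_one]
    calc G * (1 - P) * ((1 - P) * Gᴴ) = G * (1 - P - P + P * P) * Gᴴ := by noncomm_ring
      _ = G * Gᴴ - G * P * Gᴴ := by rw [hP2]; noncomm_ring
  rw [e, Matrix.trace_sub, Complex.sub_re] at h
  linarith

/-- A trace form of the bound of the invariant state by `L / d^L` times the identity: the projector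
is at most `1` and its trace is at least `d^L / L`. -/
theorem re_trace_mul_mmis_mul_le (hd : 0 < d) (hL : 0 < L) (G : Op d L) :
    (G * mmis d L * Gᴴ).trace.re ≤ L / (d : ℝ) ^ L * (G * Gᴴ).trace.re := by
  obtain ⟨t, ht, htr⟩ := exists_trace_translationProjector (d := d) hL
  have hd' : (0 : ℝ) < d := by exact_mod_cast hd
  have hL' : (0 : ℝ) < L := by exact_mod_cast hL
  have h0 : 0 < (d : ℝ) ^ L / L := by positivity
  rw [mmis, htr, Matrix.mul_smul, Matrix.smul_mul, Matrix.trace_smul, smul_eq_mul,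
    ← Complex.ofReal_inv, Complex.re_ofReal_mul]
  have h1 : t⁻¹ ≤ L / (d : ℝ) ^ L := by
    rw [← inv_div]
    exact inv_anti₀ h0 ht
  calc _ ≤ t⁻¹ * (G * Gᴴ).trace.re := by
        have : 0 ≤ t⁻¹ := inv_nonneg.2 (h0.le.trans ht)
        exact mul_le_mul_of_nonneg_left (re_trace_mul_translationProjector_mul_le hL G) this
    _ ≤ _ := mul_le_mul_of_nonneg_right h1 (re_trace_mul_conjTranspose_nonneg G)

/-- The pure states of a mixture that equals the maximally mixed translation-invariant state have
zero momentum. -/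
theorem mulVec_eq_of_sum_eq_mmis {ι : Type*} [Fintype ι] {w : ι → ℝ} {Ψ : ι → Ket d L}
    (hw : ∀ i, 0 ≤ w i) (h : ∑ i, w i • ketBra (Ψ i) = mmis d L) {i : ι} (hi : w i ≠ 0) :
    translation d L *ᵥ (Ψ i).ofLp = (Ψ i).ofLp := by
  -- `Q` annihilates the invariant state, so the weighted sum of the squared norms of `Q Ψ i`
  -- vanishes.
  set Q := translation d L - 1 with hQ
  have h1 : Q * mmis d L * Qᴴ = 0 := by
    rw [mmis, Matrix.mul_smul, hQ, sub_mul, translation_mul_translationProjector, one_mul, sub_self,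
      smul_zero, zero_mul]
  rw [← h, Finset.mul_sum, Finset.sum_mul] at h1
  have h2 : ∑ i, w i * ‖WithLp.toLp 2 (Q *ᵥ (Ψ i).ofLp)‖ ^ 2 = 0 := by
    rw [← Complex.ofReal_inj, Complex.ofReal_zero, ← Matrix.trace_zero (Config d L) ℂ, ← h1,
      Matrix.trace_sum, Complex.ofReal_sum]
    refine Finset.sum_congr rfl fun j _ => ?_
    rw [Matrix.mul_smul, Matrix.smul_mul, Matrix.trace_smul, trace_mul_ketBra_mul,
      Complex.ofReal_mul]
    rfl
  have h3 := (Finset.sum_eq_zero_iff_of_nonneg fun j _ => mul_nonneg (hw j) (sq_nonneg _)).1 h2 i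
    (Finset.mem_univ i)
  have h4 : WithLp.toLp 2 (Q *ᵥ (Ψ i).ofLp) = 0 := by
    rcases mul_eq_zero.1 h3 with h3 | h3
    · exact absurd h3 hi
    · exact norm_eq_zero.1 (pow_eq_zero_iff two_ne_zero |>.1 h3)
  have h5 : Q *ᵥ (Ψ i).ofLp = 0 := congrArg WithLp.ofLp h4
  rw [hQ, Matrix.sub_mulVec, Matrix.one_mulVec] at h5
  exact sub_eq_zero.1 h5

/-- If the maximally mixed translation-invariant state is a mixture of pure states that are
annihilated by operators on `m` neighbouring sites, then the ring is short. -/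
theorem le_of_sum_eq_mmis (hd : 2 ≤ d) {m : ℕ} (hm : 0 < m) (hmL : m ≤ L)
    {ι : Type*} [Fintype ι] {w : ι → ℝ} {Ψ : ι → Ket d L}
    (hw : ∀ i, 0 ≤ w i) (hw1 : ∑ i, w i = 1) (h : ∑ i, w i • ketBra (Ψ i) = mmis d L)
    (hΨ : ∀ i, ‖Ψ i‖ = 1)
    (hM : ∀ i, IsTranslationSymmetric (Ψ i) →
      ∃ M : Op d L, M ≠ 0 ∧ ActsOn (seg L 0 m) M ∧ M *ᵥ (Ψ i).ofLp = 0) :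
    (1 / 4 : ℝ) ≤ (16 * d ^ m * (L / m : ℕ) + 1) ^ (2 * d ^ m) *
      (L * (1 - ((d : ℝ) ^ m)⁻¹) ^ (L / m)) := by
  classical
  have hL : 0 < L := by omega
  have hK : 0 < L / m := Nat.div_pos hmL hm
  set K := L / m with hKdef
  have hNpos : 0 < d ^ m := Nat.pow_pos (by omega)
  have : Nonempty (Fin d) := ⟨⟨0, by omega⟩⟩
  -- This `M` gives the net spacing `1 / (2 * K)`, so the error over all `K` blocks is at most `1 /
  -- 2`.
  obtain ⟨𝒩, hcard, hunit, hnet⟩ := exists_net (seg L 0 m → Fin d) (M := 8 * d ^ m * K)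
    (by positivity)
  have hι : Fintype.card (seg L 0 m → Fin d) = d ^ m := by simp [card_seg hL 0 hmL]
  rw [hι] at hcard hnet
  have hKm : m * K ≤ L := Nat.mul_div_le L m
  have key : ∀ i, w i ≠ 0 → ∃ u ∈ 𝒩, (1 / 2 : ℝ) ≤
      ‖WithLp.toLp 2 (blockProj m u K *ᵥ (Ψ i).ofLp)‖ := by
    intro i hi
    have hT := mulVec_eq_of_sum_eq_mmis hw h hi
    have hTk : ∀ k, (fun σ => (Ψ i).ofLp (σ ∘ ⇑(finRotate L ^ k))) = (Ψ i).ofLp := fun k => by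
      rw [← translation_pow_mulVec]
      induction k with
      | zero => simp
      | succ k ih => rw [pow_succ' (translation d L), ← Matrix.mulVec_mulVec, ih, hT]
    obtain ⟨M, hM0, aM, hM1⟩ := hM i ⟨1, by rw [hT, one_smul]⟩
    obtain ⟨v, hv1, hv⟩ := exists_unit_vector_of_annihilator hM0 aM hM1
    obtain ⟨u, hu, huv⟩ := hnet v hv1
    refine ⟨u, hu, ?_⟩
    have h1 := norm_localOp_le_of_orthogonal (hΨ i) (hunit u hu) hv
    have h2 := norm_sub_blockProj_mulVec_le (hunit u hu) hTk (h1.trans huv) K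
    have h3 : (K : ℝ) * (4 * (d ^ m : ℕ) / (8 * d ^ m * K : ℕ)) = 1 / 2 := by
      have : (K : ℝ) ≠ 0 := by exact_mod_cast hK.ne'
      have : (d : ℝ) ^ m ≠ 0 := by exact_mod_cast hNpos.ne'
      push_cast
      field_simp
      norm_num
    have h4 := norm_sub_norm_le (WithLp.toLp 2 (Ψ i).ofLp)
      (WithLp.toLp 2 (blockProj m u K *ᵥ (Ψ i).ofLp))
    rw [← WithLp.toLp_sub] at h4
    have h5 : ‖WithLp.toLp 2 (Ψ i).ofLp‖ = 1 := hΨ i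
    linarith
  -- Summing over the whole net removes the dependence of the net point on `i`.
  have h1 : (1 / 4 : ℝ) ≤
      ∑ i, w i * ∑ u ∈ 𝒩, ‖WithLp.toLp 2 (blockProj m u K *ᵥ (Ψ i).ofLp)‖ ^ 2 := by
    rw [← one_mul (1 / 4 : ℝ), ← hw1, Finset.sum_mul]
    refine Finset.sum_le_sum fun i _ => ?_
    by_cases hi : w i = 0
    · simp [hi]
    obtain ⟨u, hu, h2⟩ := key i hi
    refine mul_le_mul_of_nonneg_left ?_ (hw i)
    refine le_trans ?_ (Finset.single_le_sum (fun u _ => sq_nonneg _) hu)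
    nlinarith
  have h2 : ∑ i, w i * ∑ u ∈ 𝒩, ‖WithLp.toLp 2 (blockProj m u K *ᵥ (Ψ i).ofLp)‖ ^ 2 =
      ∑ u ∈ 𝒩, (blockProj m u K * mmis d L * (blockProj m u K)ᴴ).trace.re := by
    simp only [Finset.mul_sum]
    rw [Finset.sum_comm]
    refine Finset.sum_congr rfl fun u _ => ?_
    rw [← h, Finset.mul_sum, Finset.sum_mul, Matrix.trace_sum, Complex.re_sum]
    refine Finset.sum_congr rfl fun i _ => ?_
    rw [Matrix.mul_smul, Matrix.smul_mul, Matrix.trace_smul, trace_mul_ketBra_mul,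
      Complex.real_smul, ← Complex.ofReal_mul, Complex.ofReal_re]
  have hd' : (d : ℝ) ^ L ≠ 0 := pow_ne_zero _ (by positivity)
  have hq : 0 ≤ 1 - ((d : ℝ) ^ m)⁻¹ := by
    have : (1 : ℝ) ≤ (d : ℝ) ^ m := by exact_mod_cast hNpos
    have := inv_le_one_of_one_le₀ this
    linarith
  have h3 : ∀ u ∈ 𝒩, (blockProj m u K * mmis d L * (blockProj m u K)ᴴ).trace.re ≤
      L * (1 - ((d : ℝ) ^ m)⁻¹) ^ K := fun u hu => by
    refine (re_trace_mul_mmis_mul_le (by omega) hL _).trans_eq ?_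
    rw [trace_blockProj (by omega) hm (hunit u hu) hKm]
    have : ((d : ℂ) ^ L * (1 - ((d : ℂ) ^ m)⁻¹) ^ K).re =
        (d : ℝ) ^ L * (1 - ((d : ℝ) ^ m)⁻¹) ^ K := by
      rw [← Complex.ofReal_re ((d : ℝ) ^ L * (1 - ((d : ℝ) ^ m)⁻¹) ^ K)]
      push_cast
      rfl
    rw [this]
    field_simp
  rw [h2] at h1
  refine h1.trans ((Finset.sum_le_card_nsmul _ _ _ h3).trans ?_)
  rw [nsmul_eq_mul]
  refine mul_le_mul_of_nonneg_right ?_ (by positivity)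
  calc (𝒩.card : ℝ) ≤ ((2 * (8 * d ^ m * K) + 1) ^ (2 * d ^ m) : ℕ) := by exact_mod_cast hcard
    _ = _ := by push_cast; ring_nf

/-! ### Asymptotics for long rings and conclusion -/

theorem exists_forall_poly_mul_pow_lt (N m : ℕ) (hm : 0 < m) {q : ℝ} (hq0 : 0 ≤ q)
    (hq1 : q < 1) : ∃ L₀ : ℕ, ∀ L : ℕ, L₀ ≤ L →
      (16 * N * (L / m : ℕ) + 1 : ℝ) ^ (2 * N) * (L * q ^ (L / m)) < 1 / 4 := by
  have h1 := tendsto_pow_const_mul_const_pow_of_abs_lt_one (2 * N + 1)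
    (show |q| < 1 by rwa [abs_of_nonneg hq0])
  have h2 := h1.const_mul ((16 * N + 1 : ℝ) ^ (2 * N) * (2 * m))
  rw [mul_zero] at h2
  obtain ⟨K₀, hK₀⟩ := Filter.eventually_atTop.1 (h2.eventually_lt_const (show (0 : ℝ) < 1 / 4 by
    norm_num))
  refine ⟨m * (K₀ + 1), fun L hL => ?_⟩
  have hK : K₀ + 1 ≤ L / m := (Nat.le_div_iff_mul_le hm).2 (by rwa [mul_comm])
  -- This bounds the expression by a constant times a power of `L / m` times a geometric term in `L
  -- / m`.
  have h3 : L ≤ 2 * m * (L / m) := by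
    have h4 := Nat.div_add_mod L m
    have h5 := Nat.mod_lt L hm
    have h6 : m * 1 ≤ m * (L / m) := Nat.mul_le_mul_left _ (by omega)
    nlinarith
  have h3' : (L : ℝ) ≤ 2 * m * (L / m : ℕ) := by exact_mod_cast h3
  refine lt_of_le_of_lt ?_ (hK₀ (L / m) (by omega))
  have hK1 : (1 : ℝ) ≤ (L / m : ℕ) := by exact_mod_cast (by omega : 1 ≤ L / m)
  set K : ℝ := ((L / m : ℕ) : ℝ)
  calc (16 * N * K + 1 : ℝ) ^ (2 * N) * (L * q ^ (L / m))
      ≤ ((16 * N + 1) * K) ^ (2 * N) * (2 * m * K * q ^ (L / m)) := by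
        gcongr
        linarith
    _ = _ := by rw [mul_pow]; ring

theorem mmis_notMem_shortRangeBipartiteMixtures (hd : 2 ≤ d) (D r : ℕ) :
    ∃ L₀ : ℕ, ∀ L : ℕ, L₀ ≤ L → mmis d L ∉ shortRangeBipartiteMixtures d L D r := by
  set m := 8 * (1 + D * r) with hm
  have hm0 : 0 < m := by omega
  have h1 : (1 : ℝ) ≤ (d : ℝ) ^ m := by exact_mod_cast Nat.one_le_pow _ _ (by omega)
  obtain ⟨L₀, hL₀⟩ := exists_forall_poly_mul_pow_lt (d ^ m) m hm0
    (q := 1 - ((d : ℝ) ^ m)⁻¹) (by linarith [inv_le_one_of_one_le₀ h1])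
    (by have : 0 < ((d : ℝ) ^ m)⁻¹ := by positivity
        linarith)
  -- The added `m` ensures that a segment of `m` sites fits on the ring.
  refine ⟨L₀ + m, fun L hL hmem => ?_⟩
  obtain ⟨ι, _, w, z, hw, hw1, hz, hsum⟩ := mem_convexHull_iff_exists_fintype.1 hmem
  choose A Ψ hA hA0 hA1 hcirc hρ using hz
  have h2 := le_of_sum_eq_mmis hd hm0 (by omega : m ≤ L) hw hw1
    (by rw [← hsum]; exact Finset.sum_congr rfl fun i _ => by rw [hρ i])
    (fun i => (hcirc i).norm_eq_one)
    fun i hi => hi.exists_annihilator hd (hA i) (hA0 i) (hA1 i) (hcirc i)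
  have h3 := hL₀ L (by omega)
  push_cast at h3
  exact absurd h2 (not_le.2 h3)

theorem exists_isCircuitOfProductState (hd : 0 < d) (D r : ℕ) :
    ∃ ℓ D' r' : ℕ, ∀ (L : ℕ) (A : Finset (Fin L)) (Ψ : Ket d L),
      IsArc A → ℓ ≤ A.card → ℓ ≤ Aᶜ.card → IsTranslationSymmetric Ψ →
      IsCircuitOfBipartiteProduct D r A Ψ → IsCircuitOfProductState D' r' Ψ := by
  refine ⟨6 * (1 + D * r), 2, 4 * (1 + D * r), fun L A Ψ hA h1 h2 hΨ h => ?_⟩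
  obtain ⟨hL, x, n, hn, rfl, hcard⟩ := hA.exists_seg
  rw [Finset.card_compl, hcard, Fintype.card_fin] at h2
  rw [hcard] at h1
  obtain ⟨C, C', hC, hC', aC, aC', hF⟩ := h.exists_disentangler hn
  exact hΨ.isCircuitOfProductState hd h.norm_eq_one (by omega) hC hC' aC aC' hF h1 (by omega)

end TranslationMMIS

end

theorem mainTheorem5 (d : ℕ) (hd : 2 ≤ d) (D r : ℕ) :
    (∃ L₀ : ℕ, ∀ L : ℕ, L₀ ≤ L →
      TranslationMMIS.mmis d L ∉ TranslationMMIS.shortRangeBipartiteMixtures d L D r) ∧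
    (∃ ℓ D' r' : ℕ, ∀ (L : ℕ) (A : Finset (Fin L)) (Ψ : TranslationMMIS.Ket d L),
      TranslationMMIS.IsArc A → ℓ ≤ A.card → ℓ ≤ Aᶜ.card →
      TranslationMMIS.IsTranslationSymmetric Ψ →
      TranslationMMIS.IsCircuitOfBipartiteProduct D r A Ψ →
      TranslationMMIS.IsCircuitOfProductState D' r' Ψ) :=
  ⟨TranslationMMIS.mmis_notMem_shortRangeBipartiteMixtures hd D r,
    TranslationMMIS.exists_isCircuitOfProductState (by omega) D r⟩
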